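/- Let $d\ge 1$. A $d$-variate extreme-value copula is a function $C:[0,1]^d\to[0,1]$ that is the restriction of the distribution function of a probability law on $\mathbb{R}^d$ with one-dimensional margins uniform on $[0,1]$, and that satisfies $C(u_1^t,\dots,u_d^t)=C(u_1,\dots,u_d)^t$ for all $u\in[0,1]^d$ and $t\ge 0$. Its stable tail dependence function is $\ell(x)=-\log C(e^{-x_1},\dots,e^{-x_d})$, $x\in[0,\infty)^d$. Let $\mathfrak{L}^X_d$ be the set of all functions $\ell:[0,\infty)^d\to\mathbb{R}$ that are the stable tail dependence function of some $d$-variate extreme-value copula and are symmetric, i.e. invariant under permutations of their arguments; we equip it with the topology of pointwise convergence. Let $S_d=\{q\in[0,1]^d: q_1+\dots+q_d=1\}$, let $\mathfrak{P}_d$ be the set of permutations of $\{1,\dots,d\}$, and write $q\sim r$ if $q=(r_{\sigma(1)},\dots,r_{\sigma(d)})$ for some $\sigma\in\mathfrak{P}_d$; the class of $q$ is $[q]$, and $S_d/{\sim}$ carries the quotient topology and its Borel $\sigma$-algebra. For every $q\in S_d$ the function $$\ell^{(d)}_q(x)=\frac{1}{(d-1)!}\sum_{\sigma\in\mathfrak{P}_d}\max\{x_1q_{\sigma(1)},\dots,x_dq_{\sigma(d)}\},\qquad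 x\in[0,\infty)^d,$$ belongs to $\mathfrak{L}^X_d$ and depends on $q$ only through $[q]$, so that we may write $\ell^{(d)}_{[q]}=\ell^{(d)}_q$. The set $\mathfrak{L}^X_d$ is a simplex: it is convex, compact and metrizable, and each of its points is the barycenter of exactly one Borel probability measure on its set of extreme points. Its set of extreme points is $\{\ell^{(d)}_{[q]} : [q]\in S_d/{\sim}\}$. For each $\ell\in\mathfrak{L}^X_d$ there is exactly one Borel probability measure $\nu$ on $S_d/{\sim}$ with $$\ell(x)=\int_{S_d/\sim}\ell^{(d)}_{[q]}(x)\,\nu(\mathrm{d}[q])\quad\text{for all }x\in[0,\infty)^d,$$ and, conversely, for every Borel probability measure $\nu$ on $S_d/{\sim}$ the right-hand side defines an element of $\mathfrak{L}^X_d$. -/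

import Mathlib

open MeasureTheory
open scoped NNReal

/-- `C` is (on the unit cube) a `d`-variate extreme-value copula: its restriction to `[0,1]^d` is
the restriction of the distribution function of a probability law on `ℝ^d` whose one-dimensional
margins are uniform on `[0,1]`, and it has the extreme-value property
`C(u₁^t, …, u_d^t) = C(u₁, …, u_d)^t`. The values of `C` outside of the cube play no role. -/
structure IsExtremeValueCopula {d : ℕ} (C : (Fin d → ℝ) → ℝ) : Prop where
  exists_law : ∃ μ : Measure (Fin d → ℝ), IsProbabilityMeasure μ ∧
    (∀ i, μ.map (fun u => u i) = (volume : Measure ℝ).restrict (Set.Icc 0 1)) ∧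
    ∀ u : Fin d → ℝ, (∀ i, u i ∈ Set.Icc (0 : ℝ) 1) → C u = μ.real (Set.Iic u)
  extreme_value : ∀ u : Fin d → ℝ, (∀ i, u i ∈ Set.Icc (0 : ℝ) 1) → ∀ t : ℝ, 0 ≤ t →
    C (fun i => u i ^ t) = C u ^ t

/-- `ℓ : [0,∞)^d → ℝ` is the stable tail dependence function of some `d`-variate extreme-value
copula `C`, that is `ℓ(x) = -log C(exp(-x₁), …, exp(-x_d))`. -/
def IsStableTailDependenceFunction {d : ℕ} (ℓ : (Fin d → ℝ≥0) → ℝ) : Prop :=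
  ∃ C : (Fin d → ℝ) → ℝ, IsExtremeValueCopula C ∧
    ∀ x : Fin d → ℝ≥0, ℓ x = -Real.log (C fun i => Real.exp (-(x i : ℝ)))

/-- The set of all `d`-variate stable tail dependence functions that are invariant under
permutations of their arguments. -/
def symmetricTailFunctions (d : ℕ) : Set ((Fin d → ℝ≥0) → ℝ) :=
  {ℓ | IsStableTailDependenceFunction ℓ ∧
    ∀ (σ : Equiv.Perm (Fin d)) (x : Fin d → ℝ≥0), ℓ (fun i => x (σ i)) = ℓ x}

/-- The function `x ↦ (1 / (d-1)!) ∑_σ max_i x_i q_{σ(i)}` for `q` in the unit simplex. -/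
noncomputable def permTail {d : ℕ} (q : stdSimplex ℝ (Fin d)) (x : Fin d → ℝ≥0) : ℝ :=
  1 / ((d - 1).factorial : ℝ) *
    ∑ σ : Equiv.Perm (Fin d), ⨆ i : Fin d, (x i : ℝ) * (q : Fin d → ℝ) (σ i)

/-- Two points of the unit simplex are equivalent if they differ by a permutation of the
coordinates. -/
def permSetoid (d : ℕ) : Setoid (stdSimplex ℝ (Fin d)) where
  r q r := ∃ σ : Equiv.Perm (Fin d), ∀ i, (q : Fin d → ℝ) i = (r : Fin d → ℝ) (σ i)
  iseqv :=
    { refl := fun _ => ⟨1, fun _ => rfl⟩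
      symm := fun ⟨σ, h⟩ => ⟨σ⁻¹, fun i => by simp [h]⟩
      trans := fun ⟨σ, h⟩ ⟨τ, k⟩ => ⟨τ * σ, fun i => by simp [h, k]⟩ }

/-- The quotient of the unit simplex by permutations of the coordinates. -/
def PermClass (d : ℕ) : Type := Quotient (permSetoid d)

/-- The class of a point of the unit simplex. -/
def PermClass.mk {d : ℕ} (q : stdSimplex ℝ (Fin d)) : PermClass d := Quotient.mk (permSetoid d) q

/-- The quotient topology. -/
instance (d : ℕ) : TopologicalSpace (PermClass d) :=
  inferInstanceAs (TopologicalSpace (Quotient (permSetoid d)))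

/-- The Borel sets of the quotient topology. -/
instance (d : ℕ) : MeasurableSpace (PermClass d) := borel (PermClass d)

instance (d : ℕ) : BorelSpace (PermClass d) := ⟨rfl⟩

/-- A metrizable (Choquet) simplex in a locally convex Hausdorff space: a metrizable compact convex
set each point of which is the barycenter of exactly one Borel probability measure on the set of
extreme points. -/
def IsMetrizableSimplex {E : Type*} [AddCommGroup E] [Module ℝ E] [TopologicalSpace E]
    [IsTopologicalAddGroup E] [ContinuousSMul ℝ E] [LocallyConvexSpace ℝ E] [T2Space E]
    (K : Set E) : Prop :=
  Convex ℝ K ∧ IsCompact K ∧ TopologicalSpace.MetrizableSpace K ∧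
    letI : MeasurableSpace (K.extremePoints ℝ) := borel (K.extremePoints ℝ)
    ∀ x ∈ K, ∃! μ : Measure (K.extremePoints ℝ), IsProbabilityMeasure μ ∧
      ∀ φ : E →L[ℝ] ℝ, φ x = ∫ e, φ e ∂μ

/-!
Write `K` for the set of symmetric stable tail dependence functions and `M` for the set of all
mixtures `x ↦ ∫ permTail q x dν([q])` with a probability measure `ν` on the classes. The theorem
says that `ν ↦ ∫ permTail q dν` is a bijection from the probability measures onto `K`; the rest is
soft. The argument has three parts.

*Mixtures belong to `K`* (`integral_tail_mem`). For a finite mixture, `exp (-ℓ)` is the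
distribution function of a vector of maxima of powers of independent uniform variables
(`isStableTailDependenceFunction_sum_iSup`). By Prokhorov's theorem the stable tail dependence
functions form a closed set for pointwise convergence, and a general mixture is a pointwise limit of
finite ones.

*Elements of `K` are mixtures* (`exists_measure_integral_tail_eq`). Let `u` have a law whose
distribution function is `exp (-ℓ)` in the coordinates `u = exp (-x)`. For `0 < α < 1` the variable
`maxᵢ xᵢ |log uᵢ|⁻ᵅ` is distributed as `ℓ(x ^ (1/α)) ^ α * E⁻ᵅ` with `E` standard exponential, and
`E⁻ᵅ` is integrable. Taking expectations and passing to polar coordinates exhibits the outer power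
`x ↦ ℓ(x ^ (1/α)) ^ α` as a mixture. Now let `α` tend to one: `ℓ` is continuous, and `M` is compact
because the probability measures on the compact space of classes are.

*The mixing measure is unique* (`measure_ext_of_integral_tail`). A measure on the classes lifts to a
symmetric measure `H` on the simplex, and the mixture determines `x ↦ ∫ maxᵢ xᵢ qᵢ dH`. The right
derivative of this function in direction `j` is the mass that `qⱼ dH` gives to the set where the
maximum is attained at `j`. For varying `x` these sets yield the joint distribution function of the
ratios `qᵢ / qⱼ`, hence `qⱼ dH`, and summing over `j` yields `H`.

With the bijection at hand, convexity and compactness of `K` follow. An extreme point is represented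
by a measure without sets of intermediate mass, that is by a point mass, and conversely a point mass
is not a proper mixture. So `[q] ↦ permTail q` is a homeomorphism onto the set of extreme points, and
the barycenter property is the bijection once more. Metrizability holds because the elements of `K`
are continuous functions on a separable space.
-/

open Set Filter Topology

/-! ### Stable tail dependence functions and their laws -/

theorem Real.iSup_le_iff_of_nonneg {ι : Type*} [Finite ι] {f : ι → ℝ} {a : ℝ} (ha : 0 ≤ a) :
    ⨆ i, f i ≤ a ↔ ∀ i, f i ≤ a :=
  ⟨fun h i => (le_ciSup (Set.finite_range f).bddAbove i).trans h, fun h => Real.iSup_le h ha⟩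

/-- A law on the line whose distribution function is the identity on `(0, 1]` is uniform. -/
theorem eq_uniform_of_measure_Iic_exp {m : Measure ℝ} [IsProbabilityMeasure m]
    (h : ∀ s : ℝ, 0 ≤ s → m (Iic (Real.exp (-s))) = ENNReal.ofReal (Real.exp (-s))) :
    m = (volume : Measure ℝ).restrict (Icc 0 1) := by
  have hneg : ∀ a : ℝ, a ≤ 0 → m (Iic a) = 0 := by
    intro a ha
    have hlim : Tendsto (fun s : ℝ => ENNReal.ofReal (Real.exp (-s))) atTop (𝓝 0) := by
      simpa using ENNReal.tendsto_ofReal (Real.tendsto_exp_neg_atTop_nhds_zero)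
    refine le_antisymm (ge_of_tendsto hlim ?_) (zero_le)
    filter_upwards [eventually_ge_atTop 0] with s hs
    rw [← h s hs]
    exact measure_mono (Iic_subset_Iic.2 (ha.trans (Real.exp_pos _).le))
  have hone : m (Iic 1) = 1 := by simpa using h 0 le_rfl
  refine Measure.ext_of_Iic _ _ fun a => ?_
  rw [Measure.restrict_apply measurableSet_Iic]
  rcases le_or_gt a 0 with ha | ha
  · rw [hneg a ha]
    refine (measure_mono_null (t := {0}) ?_ (by simp)).symm
    rintro y ⟨hy, hy0, -⟩
    exact le_antisymm (le_trans hy ha) hy0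
  · rcases le_or_gt a 1 with ha1 | ha1
    · have h1 : a = Real.exp (-(-Real.log a)) := by rw [neg_neg, Real.exp_log ha]
      have h2 : Iic a ∩ Icc (0 : ℝ) 1 = Icc 0 a := by
        ext y; simp only [mem_inter_iff, mem_Iic, mem_Icc]; constructor
        · rintro ⟨h1, h2, h3⟩; exact ⟨h2, h1⟩
        · rintro ⟨h1, h2⟩; exact ⟨h2, h1, h2.trans ha1⟩
      rw [h2, Real.volume_Icc, sub_zero]
      conv_lhs => rw [h1]
      rw [h _ (by have := Real.log_nonpos ha.le ha1; linarith), ← h1]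
    · have h2 : Iic a ∩ Icc (0 : ℝ) 1 = Icc 0 1 := by
        ext y; simp only [mem_inter_iff, mem_Iic, mem_Icc]; constructor
        · rintro ⟨h1, h2, h3⟩; exact ⟨h2, h3⟩
        · rintro ⟨h1, h2⟩; exact ⟨h2.trans ha1.le, h1, h2⟩
      rw [h2, Real.volume_Icc, sub_zero, ENNReal.ofReal_one]
      exact le_antisymm prob_le_one (hone ▸ measure_mono (Iic_subset_Iic.2 ha1.le))

theorem uniform_Iic_exp {s : ℝ} (hs : 0 ≤ s) :
    (volume : Measure ℝ).restrict (Icc 0 1) (Iic (Real.exp (-s)))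
      = ENNReal.ofReal (Real.exp (-s)) := by
  have ha1 : Real.exp (-s) ≤ 1 := Real.exp_le_one_iff.2 (by linarith)
  have h2 : Iic (Real.exp (-s)) ∩ Icc (0 : ℝ) 1 = Icc 0 (Real.exp (-s)) := by
    ext y; simp only [mem_inter_iff, mem_Iic, mem_Icc]; constructor
    · rintro ⟨h1, h2, h3⟩; exact ⟨h2, h1⟩
    · rintro ⟨h1, h2⟩; exact ⟨h2, h1, h2.trans ha1⟩
  rw [Measure.restrict_apply measurableSet_Iic, h2, Real.volume_Icc, sub_zero]

instance isProbabilityMeasure_uniform :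
    IsProbabilityMeasure ((volume : Measure ℝ).restrict (Icc 0 1)) := ⟨by simp⟩

theorem ae_mem_cube_of_uniform {d : ℕ} {μ : Measure (Fin d → ℝ)}
    (hmarg : ∀ i, μ.map (fun u => u i) = (volume : Measure ℝ).restrict (Icc 0 1)) :
    ∀ᵐ u ∂μ, ∀ i, u i ∈ Ioo (0 : ℝ) 1 := by
  rw [ae_all_iff]
  intro i
  have h : ∀ᵐ y ∂(μ.map fun u => u i), y ∈ Ioo (0 : ℝ) 1 := by
    rw [hmarg i, ← restrict_Ioo_eq_restrict_Icc]
    exact ae_restrict_mem measurableSet_Ioo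
  exact ae_of_ae_map (measurable_pi_apply i).aemeasurable h

/-- A homogeneous function `ℓ`, normalized on the coordinate axes, is a stable tail dependence
function as soon as `exp (-ℓ)` is a distribution function in the coordinates `u = exp (-x)`;
the uniform margins are automatic. -/
theorem IsStableTailDependenceFunction.of_law {d : ℕ} {ℓ : (Fin d → ℝ≥0) → ℝ}
    (hom : ∀ (t : ℝ≥0) (x : Fin d → ℝ≥0), ℓ (fun i => t * x i) = t * ℓ x)
    (hone : ∀ i, ℓ (Pi.single i 1) = 1) (μ : Measure (Fin d → ℝ)) [IsProbabilityMeasure μ]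
    (hμ : ∀ x : Fin d → ℝ≥0, μ.real (Iic fun i => Real.exp (-(x i : ℝ))) = Real.exp (-ℓ x)) :
    IsStableTailDependenceFunction ℓ := by
  have hzero : ℓ (fun _ => 0) = 0 := by simpa using hom 0 (fun _ => 0)
  have hle : ∀ᵐ u ∂μ, u ∈ Iic (fun _ : Fin d => (1 : ℝ)) := by
    have := hμ fun _ => 0
    rw [hzero] at this
    refine (prob_compl_eq_zero_iff measurableSet_Iic).2 ?_
    simpa [Measure.real, ENNReal.toReal_eq_one_iff] using this
  have hmarg : ∀ i, μ.map (fun u => u i) = (volume : Measure ℝ).restrict (Icc 0 1) := by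
    intro i
    have : IsProbabilityMeasure (μ.map fun u => u i) :=
      Measure.isProbabilityMeasure_map (measurable_pi_apply i).aemeasurable
    refine eq_uniform_of_measure_Iic_exp fun s hs => ?_
    rw [Measure.map_apply (measurable_pi_apply i) measurableSet_Iic]
    have h1 := hμ fun j => s.toNNReal * (Pi.single i 1 : Fin d → ℝ≥0) j
    rw [hom, hone, mul_one, Real.coe_toNNReal s hs] at h1
    rw [← ENNReal.ofReal_eq_ofReal_iff (by positivity) (by positivity), ofReal_measureReal] at h1
    rw [← h1]
    refine measure_congr ?_
    filter_upwards [hle] with u hu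
    refine propext ⟨fun (h : u i ≤ Real.exp (-s)) j => ?_, fun h => ?_⟩
    · rcases eq_or_ne j i with rfl | hj
      · simpa [hs] using h
      · simpa [Pi.single_eq_of_ne hj] using hu j
    · have : u i ≤ Real.exp (-s) := by simpa [hs] using h i
      exact this
  refine ⟨fun u => μ.real (Iic u), ⟨⟨μ, inferInstance, hmarg, fun _ _ => rfl⟩, ?_⟩, fun x => ?_⟩
  · intro u hu t ht
    by_cases hpos : ∀ i, 0 < u i
    · have h1 : ∀ i, u i = Real.exp (-((-Real.log (u i)).toNNReal : ℝ)) := fun i => by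
        rw [Real.coe_toNNReal _ (by have := Real.log_nonpos (hu i).1 (hu i).2; linarith), neg_neg,
          Real.exp_log (hpos i)]
      set x : Fin d → ℝ≥0 := fun i => (-Real.log (u i)).toNNReal
      have h2 : u = fun i => Real.exp (-(x i : ℝ)) := funext h1
      have h3 : (fun i => u i ^ t) = fun i => Real.exp (-((t.toNNReal * x i : ℝ≥0) : ℝ)) := by
        funext i
        rw [h2, ← Real.exp_mul, NNReal.coe_mul, Real.coe_toNNReal t ht]
        ring_nf
      simp only [h3]
      rw [hμ (fun i => t.toNNReal * x i), hom, h2, hμ x, ← Real.exp_mul, Real.coe_toNNReal t ht]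
      ring_nf
    · push Not at hpos
      obtain ⟨i, hi⟩ := hpos
      have hi0 : u i = 0 := le_antisymm hi (hu i).1
      have hnull : ∀ v : Fin d → ℝ, v i = 0 → μ.real (Iic v) = 0 := by
        intro v hv
        rw [measureReal_eq_zero_iff]
        refine measure_mono_null (t := (fun u => u i) ⁻¹' Iic 0) (fun y hy => ?_) ?_
        · simpa [hv] using hy i
        · rw [← Measure.map_apply (measurable_pi_apply i) measurableSet_Iic, hmarg i,
            Measure.restrict_apply measurableSet_Iic]
          refine measure_mono_null (t := {0}) ?_ (by simp)
          rintro y ⟨hy, hy0, -⟩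
          exact le_antisymm hy hy0
      rcases ht.eq_or_lt with rfl | ht
      · have := hμ fun _ => 0
        rw [hzero] at this
        simpa using this
      · rw [hnull u hi0, hnull _ (by simp [hi0, Real.zero_rpow ht.ne']), Real.zero_rpow ht.ne']
  · simp only [hμ x, Real.log_exp, neg_neg]

/-- A stable tail dependence function is homogeneous, normalized on the coordinate axes, and
`exp (-ℓ)` is a distribution function with uniform margins. -/
theorem IsStableTailDependenceFunction.exists_law {d : ℕ} {ℓ : (Fin d → ℝ≥0) → ℝ}
    (h : IsStableTailDependenceFunction ℓ) :
    (∀ (t : ℝ≥0) (x : Fin d → ℝ≥0), ℓ (fun i => t * x i) = t * ℓ x) ∧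
    (∀ i, ℓ (Pi.single i 1) = 1) ∧
    ∃ μ : Measure (Fin d → ℝ), IsProbabilityMeasure μ ∧
      (∀ i, μ.map (fun u => u i) = (volume : Measure ℝ).restrict (Icc 0 1)) ∧
      ∀ x : Fin d → ℝ≥0, μ.real (Iic fun i => Real.exp (-(x i : ℝ))) = Real.exp (-ℓ x) := by
  obtain ⟨C, ⟨⟨μ, hprob, hmarg, hC⟩, hev⟩, hℓ⟩ := h
  have hcube : ∀ x : Fin d → ℝ≥0, ∀ i, Real.exp (-(x i : ℝ)) ∈ Icc (0 : ℝ) 1 := fun x i =>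
    ⟨(Real.exp_pos _).le, Real.exp_le_one_iff.2 (by simp)⟩
  have hmarg' : ∀ (i : Fin d) (s : ℝ), 0 ≤ s →
      μ ((fun u => u i) ⁻¹' Iic (Real.exp (-s))) = ENNReal.ofReal (Real.exp (-s)) := by
    intro i s hs
    rw [← Measure.map_apply (measurable_pi_apply i) measurableSet_Iic, hmarg i, uniform_Iic_exp hs]
  -- Were `C` to vanish at `exp (-x)`, it would vanish at `exp (-t x)` for all `t > 0`, which is
  -- impossible by the union bound for small `t`; so `log C` is never a junk value.
  have hpos : ∀ x : Fin d → ℝ≥0, 0 < C fun i => Real.exp (-(x i : ℝ)) := by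
    intro x
    refine lt_of_le_of_ne (by rw [hC _ (hcube x)]; exact measureReal_nonneg) fun h0 => ?_
    have hb : ∀ t : ℝ, 0 < t → 1 ≤ ∑ i, (1 - Real.exp (-(t * x i))) := by
      intro t ht
      have h1 := hev _ (hcube x) t ht.le
      rw [← h0, Real.zero_rpow ht.ne'] at h1
      have h2 : (fun i => Real.exp (-(x i : ℝ)) ^ t) = fun i => Real.exp (-(t * x i)) := by
        funext i; rw [← Real.exp_mul]; ring_nf
      have h3 := hcube fun i => t.toNNReal * x i
      simp only [NNReal.coe_mul, Real.coe_toNNReal t ht.le] at h3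
      rw [h2, hC _ h3] at h1
      have h4 : (univ : Set (Fin d → ℝ)) = (Iic fun i => Real.exp (-(t * x i))) ∪
          ⋃ i, ((fun u => u i) ⁻¹' Iic (Real.exp (-(t * x i))))ᶜ := by
        ext y
        simp only [mem_univ, mem_union, mem_Iic, mem_iUnion, mem_compl_iff, mem_preimage, true_iff,
          Pi.le_def]
        exact or_iff_not_imp_left.2 fun h => by simpa using h
      calc (1 : ℝ) = μ.real univ := by simp
        _ ≤ μ.real (Iic fun i => Real.exp (-(t * x i))) +
            μ.real (⋃ i, ((fun u => u i) ⁻¹' Iic (Real.exp (-(t * x i))))ᶜ) := by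
          rw [h4]; exact measureReal_union_le _ _
        _ ≤ 0 + ∑ i, μ.real ((fun u => u i) ⁻¹' Iic (Real.exp (-(t * x i))))ᶜ :=
          add_le_add h1.le (measureReal_iUnion_fintype_le _)
        _ = ∑ i, (1 - Real.exp (-(t * x i))) := by
          rw [zero_add]
          refine Finset.sum_congr rfl fun i _ => ?_
          rw [probReal_compl_eq_one_sub (measurable_pi_apply i measurableSet_Iic), Measure.real,
            hmarg' i _ (by positivity), ENNReal.toReal_ofReal (Real.exp_pos _).le]
    have hlim : Tendsto (fun t : ℝ => ∑ i, (1 - Real.exp (-(t * x i)))) (𝓝[>] 0) (𝓝 0) := by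
      have hc : Continuous fun t : ℝ => ∑ i, (1 - Real.exp (-(t * x i))) := by fun_prop
      have := hc.tendsto 0
      simp only [zero_mul, neg_zero, Real.exp_zero, sub_self, Finset.sum_const_zero] at this
      exact this.mono_left nhdsWithin_le_nhds
    have := ge_of_tendsto hlim (eventually_mem_nhdsWithin.mono hb)
    linarith
  have hexp : ∀ x : Fin d → ℝ≥0,
      μ.real (Iic fun i => Real.exp (-(x i : ℝ))) = Real.exp (-ℓ x) := by
    intro x
    rw [hℓ, neg_neg, Real.exp_log (hpos x), hC _ (hcube x)]
  refine ⟨fun t x => ?_, fun i => ?_, μ, hprob, hmarg, hexp⟩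
  · have h2 : (fun i => Real.exp (-((t * x i : ℝ≥0) : ℝ)))
        = fun i => Real.exp (-(x i : ℝ)) ^ (t : ℝ) := by
      funext i; rw [← Real.exp_mul]; push_cast; ring_nf
    have h3 := hev _ (hcube x) t t.2
    rw [hℓ, hℓ, h2, h3, Real.log_rpow (hpos x)]
    ring
  · have h1 := hexp (Pi.single i 1)
    have h2 : μ (Iic fun j => Real.exp (-((Pi.single i 1 : Fin d → ℝ≥0) j : ℝ)))
        = ENNReal.ofReal (Real.exp (-1)) := by
      rw [← hmarg' i 1 zero_le_one]
      refine measure_congr ?_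
      filter_upwards [ae_mem_cube_of_uniform hmarg] with u hu
      refine propext ⟨fun h => ?_, fun (h : u i ≤ Real.exp (-1)) j => ?_⟩
      · have : u i ≤ Real.exp (-1) := by simpa using h i
        exact this
      rcases eq_or_ne j i with rfl | hj
      · simpa using h
      · simpa [Pi.single_eq_of_ne hj] using (hu j).2.le
    rw [Measure.real, h2, ENNReal.toReal_ofReal (Real.exp_pos _).le, Real.exp_eq_exp] at h1
    linarith

/-! ### Finite mixtures and pointwise limits -/

/-- Mixtures `∑ₖ maxᵢ xᵢ wₖᵢ` with finitely many spectral vectors `wₖ` of mean one are stable tail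
dependence functions: `exp (-ℓ)` is the distribution function of the vector with coordinates
`maxₖ Vₖ ^ (1 / wₖᵢ)` where the `Vₖ` are independent and uniform. -/
theorem isStableTailDependenceFunction_sum_iSup {d : ℕ} [NeZero d] {κ : Type*} [Fintype κ]
    (w : κ → Fin d → ℝ) (hw : ∀ k i, 0 ≤ w k i) (hsum : ∀ i, ∑ k, w k i = 1) :
    IsStableTailDependenceFunction fun x : Fin d → ℝ≥0 => ∑ k, ⨆ i, (x i : ℝ) * w k i := by
  let lam : Measure ℝ := (volume : Measure ℝ).restrict (Icc 0 1)
  let P : Measure (κ → ℝ) := Measure.pi fun _ => lam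
  -- the exponent `1 / 0` stands for infinity, so that a vanishing weight contributes `V ^ ∞ = 0`
  let U : (κ → ℝ) → Fin d → ℝ := fun V i => ⨆ k, if w k i = 0 then 0 else V k ^ (w k i)⁻¹
  have hU : Measurable U := by
    refine measurable_pi_lambda _ fun i => Measurable.iSup fun k => ?_
    split_ifs
    · exact measurable_const
    · exact (measurable_pi_apply k).pow_const _
  have : IsProbabilityMeasure (P.map U) := Measure.isProbabilityMeasure_map hU.aemeasurable
  refine IsStableTailDependenceFunction.of_law (fun t x => ?_) (fun i => ?_) (P.map U) fun x => ?_
  · rw [Finset.mul_sum]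
    refine Finset.sum_congr rfl fun k _ => ?_
    rw [Real.mul_iSup_of_nonneg (NNReal.coe_nonneg t)]
    congr 1 with i
    push_cast; ring
  · rw [← hsum i]
    refine Finset.sum_congr rfl fun k _ => le_antisymm (Real.iSup_le (fun j => ?_) (hw k i)) ?_
    · rcases eq_or_ne j i with rfl | hj
      · simp
      · simpa [Pi.single_eq_of_ne hj] using hw k i
    · refine le_trans ?_ (le_ciSup (Set.finite_range _).bddAbove i)
      simp
  · rw [Measure.real, Measure.map_apply hU measurableSet_Iic]
    set M : κ → ℝ := fun k => ⨆ i, (x i : ℝ) * w k i with hM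
    have hM0 : ∀ k, 0 ≤ M k := fun k => Real.iSup_nonneg fun i => mul_nonneg (x i).2 (hw k i)
    have hae : ∀ᵐ V ∂P, ∀ k, V k ∈ Icc (0 : ℝ) 1 := by
      rw [ae_all_iff]
      intro k
      have h0 : P.map (fun V => V k) = lam := (measurePreserving_eval (fun _ => lam) k).map_eq
      refine ae_of_ae_map (f := fun V : κ → ℝ => V k) (p := fun y => y ∈ Icc (0 : ℝ) 1)
        (measurable_pi_apply k).aemeasurable ?_
      rw [h0]
      exact ae_restrict_mem measurableSet_Icc
    have hset : P (U ⁻¹' Iic fun i => Real.exp (-(x i : ℝ))) =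
        P (Set.pi univ fun k => Iic (Real.exp (-M k))) := by
      refine measure_congr ?_
      filter_upwards [hae] with V hV
      have hk : ∀ k i, (if w k i = 0 then 0 else V k ^ (w k i)⁻¹) ≤ Real.exp (-(x i : ℝ)) ↔
          V k ≤ Real.exp (-(x i * w k i)) := by
        intro k i
        split_ifs with h
        · simpa [h, (Real.exp_pos _).le] using (hV k).2
        · rw [Real.rpow_inv_le_iff_of_pos (hV k).1 (Real.exp_pos _).le
            (lt_of_le_of_ne (hw k i) (Ne.symm h)), ← Real.exp_mul, neg_mul]
      have h1 : (∀ i, U V i ≤ Real.exp (-(x i : ℝ))) ↔ ∀ k, V k ≤ Real.exp (-M k) := by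
        simp only [U, Real.iSup_le_iff_of_nonneg (Real.exp_pos _).le, hk]
        rw [forall_comm]
        refine forall_congr' fun k => ⟨fun h => ?_, fun h i => h.trans ?_⟩
        · obtain ⟨i, hi⟩ := exists_eq_ciSup_of_finite (f := fun i => (x i : ℝ) * w k i)
          exact (h i).trans_eq (by rw [hi])
        · exact Real.exp_le_exp.2 (neg_le_neg
            (le_ciSup (f := fun i => (x i : ℝ) * w k i) (Set.finite_range _).bddAbove i))
      refine propext (Iff.trans h1 ?_)
      exact ⟨fun h k _ => h k, fun h k => h k (mem_univ k)⟩
    rw [hset, Measure.pi_pi]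
    simp only [lam, uniform_Iic_exp (hM0 _)]
    rw [ENNReal.toReal_prod, ← Finset.sum_neg_distrib, Real.exp_sum]
    exact Finset.prod_congr rfl fun k _ => ENNReal.toReal_ofReal (Real.exp_pos _).le

/-- Pointwise limits of stable tail dependence functions are stable tail dependence functions:
the laws of the associated copulas all live on the cube, hence are tight, and the distribution
function of a limit law is continuous as its margins are uniform. -/
theorem isClosed_isStableTailDependenceFunction (d : ℕ) :
    IsClosed {ℓ : (Fin d → ℝ≥0) → ℝ | IsStableTailDependenceFunction ℓ} := by
  refine isClosed_iff_ultrafilter.2 fun f 𝒰 hf hmem => ?_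
  choose! hom hone μ hprob hmarg hexp using
    fun ℓ (h : IsStableTailDependenceFunction (d := d) ℓ) => h.exists_law
  have hlim : ∀ x, Tendsto (fun ℓ : (Fin d → ℝ≥0) → ℝ => ℓ x) 𝒰 (𝓝 (f x)) := fun x =>
    ((continuous_apply x).tendsto f).mono_left hf
  let S : Set (ProbabilityMeasure (Fin d → ℝ)) :=
    {P | ∀ i, (P : Measure (Fin d → ℝ)).map (fun u => u i) = (volume : Measure ℝ).restrict (Icc 0 1)}
  have hS : IsCompact (closure S) := by
    refine isCompact_closure_of_isTightMeasureSet ?_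
    rw [isTightMeasureSet_iff_exists_isCompact_measure_compl_le]
    intro ε _
    refine ⟨Set.pi univ fun _ => Icc (0 : ℝ) 1, isCompact_univ_pi fun _ => isCompact_Icc, ?_⟩
    rintro _ ⟨P, hP, rfl⟩
    refine le_of_eq_of_le ?_ zero_le
    have := ae_mem_cube_of_uniform hP
    rw [ae_iff] at this
    refine measure_mono_null (fun u hu => ?_) this
    exact fun h => hu fun i _ => Ioo_subset_Icc_self (h i)
  classical
  obtain ⟨P₀⟩ : Nonempty (ProbabilityMeasure (Fin d → ℝ)) := ⟨⟨Measure.dirac 0, inferInstance⟩⟩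
  let Q : ((Fin d → ℝ≥0) → ℝ) → ProbabilityMeasure (Fin d → ℝ) := fun ℓ =>
    if h : IsStableTailDependenceFunction ℓ then ⟨μ ℓ, hprob ℓ h⟩ else P₀
  have hQ : ∀ ℓ, IsStableTailDependenceFunction ℓ → (Q ℓ : Measure (Fin d → ℝ)) = μ ℓ :=
    fun ℓ h => by simp [Q, h]
  have hQS : ∀ᶠ ℓ in (𝒰 : Filter ((Fin d → ℝ≥0) → ℝ)), Q ℓ ∈ S := by
    filter_upwards [hmem] with ℓ hℓ i
    rw [hQ ℓ hℓ]
    exact hmarg ℓ hℓ i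
  obtain ⟨P, -, hP⟩ := hS.ultrafilter_le_nhds (𝒰.map Q)
    (le_principal_iff.2 (hQS.mono fun ℓ h => subset_closure h))
  have hP' : Tendsto Q 𝒰 (𝓝 P) := hP
  have hPmarg : ∀ i, (P : Measure (Fin d → ℝ)).map (fun u => u i)
      = (volume : Measure ℝ).restrict (Icc 0 1) := by
    intro i
    have h1 := ProbabilityMeasure.tendsto_map_of_tendsto_of_continuous Q P hP'
      (continuous_apply i)
    let lam : ProbabilityMeasure ℝ := ⟨(volume : Measure ℝ).restrict (Icc 0 1), inferInstance⟩
    have h2 : Tendsto (fun ℓ => (Q ℓ).map (continuous_apply i).measurable.aemeasurable) 𝒰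
        (𝓝 lam) := by
      refine tendsto_const_nhds.congr' ?_
      filter_upwards [hQS] with ℓ hℓ
      exact Subtype.ext (hℓ i).symm
    have h3 := tendsto_nhds_unique h1 h2
    exact congrArg Subtype.val h3
  have hPexp : ∀ x : Fin d → ℝ≥0,
      (P : Measure (Fin d → ℝ)).real (Iic fun i => Real.exp (-(x i : ℝ))) = Real.exp (-f x) := by
    intro x
    set a : Fin d → ℝ := fun i => Real.exp (-(x i : ℝ)) with ha
    have hfr : (P : Measure (Fin d → ℝ)) (frontier (Iic a)) = 0 := by
      refine measure_mono_null (t := ⋃ i, (fun u => u i) ⁻¹' {a i}) (fun u hu => ?_) ?_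
      · have hle : u ∈ Iic a := isClosed_Iic.frontier_subset hu
        by_contra hne
        have hlt : ∀ i, u i < a i := fun i => lt_of_le_of_ne (hle i) fun h =>
          hne (mem_iUnion.2 ⟨i, h⟩)
        refine hu.2 (mem_interior.2 ⟨Set.pi univ fun i => Iio (a i), ?_, ?_, fun i _ => hlt i⟩)
        · exact fun v hv i => (hv i (mem_univ i)).le
        · exact isOpen_set_pi finite_univ fun i _ => isOpen_Iio
      · rw [measure_iUnion_null_iff]
        intro i
        rw [← Measure.map_apply (measurable_pi_apply i) (measurableSet_singleton _), hPmarg i]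
        rw [Measure.restrict_apply (measurableSet_singleton _)]
        exact measure_mono_null inter_subset_left Real.volume_singleton
    have h1 := ProbabilityMeasure.tendsto_measure_of_null_frontier_of_tendsto' hP' hfr
    have h2 : Tendsto (fun ℓ => (Q ℓ : Measure (Fin d → ℝ)).real (Iic a)) 𝒰
        (𝓝 ((P : Measure (Fin d → ℝ)).real (Iic a))) :=
      (ENNReal.tendsto_toReal (measure_ne_top _ _)).comp h1
    refine tendsto_nhds_unique h2 ?_
    refine ((Real.continuous_exp.tendsto _).comp (hlim x).neg).congr' ?_
    filter_upwards [hmem] with ℓ hℓ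
    rw [hQ ℓ hℓ, hexp ℓ hℓ x]
    rfl
  refine IsStableTailDependenceFunction.of_law (fun t x => ?_) (fun i => ?_) P hPexp
  · refine tendsto_nhds_unique (hlim _) (((hlim x).const_mul (t : ℝ)).congr' ?_)
    filter_upwards [hmem] with ℓ hℓ
    exact (hom ℓ hℓ t x).symm
  · refine tendsto_nhds_unique (hlim _) (tendsto_const_nhds.congr' ?_)
    filter_upwards [hmem] with ℓ hℓ
    exact (hone ℓ hℓ i).symm

/-! ### The space of classes and the mixtures it parametrizes -/

/-- Two families with the same multiset of values differ by a permutation of the indices. -/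
theorem exists_perm_of_map_univ_eq {ι β : Type*} [Fintype ι] [DecidableEq β] {q r : ι → β}
    (h : Finset.univ.val.map q = Finset.univ.val.map r) :
    ∃ σ : Equiv.Perm ι, ∀ i, q i = r (σ i) := by
  have hc : ∀ y, Nonempty ({i // q i = y} ≃ {i // r i = y}) := by
    intro y
    refine ⟨Fintype.equivOfCardEq ?_⟩
    have h1 := congrArg (Multiset.count y) h
    rw [Multiset.count_map, Multiset.count_map] at h1
    rw [Fintype.card_subtype, Fintype.card_subtype]
    simpa only [Finset.card_def, Finset.filter_val, eq_comm (a := y)] using h1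
  let e := fun y => (hc y).some
  refine ⟨(Equiv.sigmaFiberEquiv q).symm.trans
    ((Equiv.sigmaCongrRight e).trans (Equiv.sigmaFiberEquiv r)), fun i => ?_⟩
  exact (e (q i) ⟨i, rfl⟩).2.symm

namespace PermClass

variable {d : ℕ}

theorem continuous_mk : Continuous (PermClass.mk : stdSimplex ℝ (Fin d) → PermClass d) :=
  continuous_quotient_mk'

theorem mk_surjective : Function.Surjective (PermClass.mk : stdSimplex ℝ (Fin d) → PermClass d) :=
  Quotient.mk_surjective

instance : CompactSpace (PermClass d) := inferInstanceAs (CompactSpace (Quotient (permSetoid d)))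

/-- The values at the natural numbers of the monic polynomial whose roots are the coordinates
of `q`. They determine the polynomial, hence the class of `q`. -/
noncomputable def evalProd (c : PermClass d) (n : ℕ) : ℝ :=
  Quotient.lift (fun q : stdSimplex ℝ (Fin d) => ∏ i, ((n : ℝ) - (q : Fin d → ℝ) i))
    (fun q r hqr => by
      obtain ⟨σ, h⟩ : ∃ σ : Equiv.Perm (Fin d), ∀ i, (q : Fin d → ℝ) i = (r : Fin d → ℝ) (σ i) :=
        hqr
      simpa only [h] using Equiv.prod_comp σ fun i => (n : ℝ) - (r : Fin d → ℝ) i) c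

theorem continuous_evalProd : Continuous (evalProd : PermClass d → ℕ → ℝ) := by
  refine continuous_pi fun n => Continuous.quotient_lift ?_ _
  have : ∀ i, Continuous fun q : stdSimplex ℝ (Fin d) => (q : Fin d → ℝ) i := fun i =>
    (continuous_apply i).comp continuous_subtype_val
  exact continuous_finsetProd _ fun i _ => continuous_const.sub (this i)

theorem evalProd_injective : Function.Injective (evalProd : PermClass d → ℕ → ℝ) := by
  intro c e h
  obtain ⟨q, rfl⟩ := mk_surjective c
  obtain ⟨r, rfl⟩ := mk_surjective e
  refine Quotient.sound (exists_perm_of_map_univ_eq ?_)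
  let p : stdSimplex ℝ (Fin d) → Polynomial ℝ := fun q =>
    ((Finset.univ.val.map (q : Fin d → ℝ)).map fun a => Polynomial.X - Polynomial.C a).prod
  have hp : ∀ (q : stdSimplex ℝ (Fin d)) (n : ℕ), (p q).eval (n : ℝ) = evalProd (mk q) n := by
    intro q n
    simp only [p, Multiset.map_map, Polynomial.eval_multiset_prod]
    simp [evalProd, PermClass.mk, Finset.prod]
  have h1 : p q = p r := by
    refine Polynomial.eq_of_infinite_eval_eq _ _ (Set.infinite_of_injective_forall_mem
      (f := fun n : ℕ => (n : ℝ)) Nat.cast_injective fun n => ?_)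
    rw [mem_ofPred_eq, hp, hp, h]
  have h2 := congrArg Polynomial.roots h1
  simpa only [p, Polynomial.roots_multiset_prod_X_sub_C] using h2

instance : T2Space (PermClass d) := T2Space.of_injective_continuous evalProd_injective
  continuous_evalProd

theorem isClosedEmbedding_evalProd : IsClosedEmbedding (evalProd : PermClass d → ℕ → ℝ) :=
  continuous_evalProd.isClosedEmbedding evalProd_injective

instance : PolishSpace (PermClass d) := isClosedEmbedding_evalProd.polishSpace

end PermClass

theorem Real.continuous_iSup_of_finite {ι X : Type*} [Finite ι] [TopologicalSpace X]
    {f : ι → X → ℝ} (hf : ∀ i, Continuous (f i)) : Continuous fun x => ⨆ i, f i x := by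
  have := Fintype.ofFinite ι
  rcases isEmpty_or_nonempty ι with h | h
  · simp only [Real.iSup_of_isEmpty]; exact continuous_const
  · simp only [← Finset.sup'_univ_eq_ciSup]
    exact Continuous.finset_sup'_apply _ fun i _ => hf i

section permTail

variable {d : ℕ}

theorem continuous_stdSimplex_apply (i : Fin d) :
    Continuous fun q : stdSimplex ℝ (Fin d) => (q : Fin d → ℝ) i :=
  (continuous_apply i).comp continuous_subtype_val

theorem continuous_permTail_apply (x : Fin d → ℝ≥0) :
    Continuous fun q : stdSimplex ℝ (Fin d) => permTail q x := by
  refine continuous_const.mul (continuous_finsetSum _ fun σ _ => ?_)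
  exact Real.continuous_iSup_of_finite fun i =>
    continuous_const.mul (continuous_stdSimplex_apply (σ i))

theorem permTail_comp_perm (q : stdSimplex ℝ (Fin d)) (σ : Equiv.Perm (Fin d))
    (x : Fin d → ℝ≥0) : permTail q (fun i => x (σ i)) = permTail q x := by
  unfold permTail
  congr 1
  rw [← Equiv.sum_comp (Equiv.mulRight σ)]
  refine Finset.sum_congr rfl fun τ _ => ?_
  exact Equiv.iSup_comp (g := fun i => (x i : ℝ) * (q : Fin d → ℝ) (τ i)) σ

theorem permTail_eq_of_perm {q r : stdSimplex ℝ (Fin d)} (σ : Equiv.Perm (Fin d))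
    (h : ∀ i, (q : Fin d → ℝ) i = (r : Fin d → ℝ) (σ i)) : permTail q = permTail r := by
  funext x
  unfold permTail
  congr 1
  rw [← Equiv.sum_comp (Equiv.mulLeft σ) fun τ => ⨆ i, (x i : ℝ) * (r : Fin d → ℝ) (τ i)]
  simp [h]

theorem permTail_eq_of_rel {q r : stdSimplex ℝ (Fin d)} (h : permSetoid d q r) :
    permTail q = permTail r :=
  Exists.elim h permTail_eq_of_perm

theorem sum_perm_apply [NeZero d] (q : stdSimplex ℝ (Fin d)) (i : Fin d) :
    ∑ σ : Equiv.Perm (Fin d), (q : Fin d → ℝ) (σ i) = ((d - 1).factorial : ℝ) := by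
  have hconst : ∀ j, ∑ σ : Equiv.Perm (Fin d), (q : Fin d → ℝ) (σ j) =
      ∑ σ : Equiv.Perm (Fin d), (q : Fin d → ℝ) (σ i) := by
    intro j
    rw [← Equiv.sum_comp (Equiv.mulRight (Equiv.swap i j))]
    simp
  have htot : ∑ j, ∑ σ : Equiv.Perm (Fin d), (q : Fin d → ℝ) (σ j) = (d.factorial : ℝ) := by
    rw [Finset.sum_comm]
    simp [Equiv.sum_comp _ (q : Fin d → ℝ), Finset.card_univ, Fintype.card_perm]
  simp only [hconst, Finset.sum_const, Finset.card_univ, Fintype.card_fin, nsmul_eq_mul] at htot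
  rw [← Nat.mul_factorial_pred (NeZero.ne d), Nat.cast_mul] at htot
  exact mul_left_cancel₀ (Nat.cast_ne_zero.2 (NeZero.ne d)) htot

end permTail

/-- The function `permTail q`, as a function of the class of `q`. -/
noncomputable def PermClass.tail {d : ℕ} (c : PermClass d) : (Fin d → ℝ≥0) → ℝ :=
  Quotient.lift permTail (fun _ _ hqr => permTail_eq_of_rel hqr) c

namespace PermClass

variable {d : ℕ}

@[simp]
theorem tail_mk (q : stdSimplex ℝ (Fin d)) : tail (PermClass.mk q) = permTail q := rfl

theorem continuous_tail_apply (x : Fin d → ℝ≥0) : Continuous fun c : PermClass d => c.tail x :=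
  (isQuotientMap_quotient_mk' (s := permSetoid d)).continuous_iff.2 (continuous_permTail_apply x)

theorem continuous_tail : Continuous (tail : PermClass d → (Fin d → ℝ≥0) → ℝ) :=
  continuous_pi continuous_tail_apply

theorem integrable_tail_apply (ν : Measure (PermClass d)) [IsFiniteMeasure ν] (x : Fin d → ℝ≥0) :
    Integrable (fun c => c.tail x) ν :=
  (continuous_tail_apply x).integrable_of_hasCompactSupport
    (HasCompactSupport.of_compactSpace _)

theorem integrable_tail (ν : Measure (PermClass d)) [IsFiniteMeasure ν] (F : Finset (Fin d → ℝ≥0)) :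
    Integrable (fun c (x : F) => c.tail x) ν :=
  Integrable.of_eval fun x => integrable_tail_apply ν x

end PermClass

theorem isClosed_symmetricTailFunctions (d : ℕ) : IsClosed (symmetricTailFunctions d) := by
  have h : symmetricTailFunctions d = {ℓ | IsStableTailDependenceFunction ℓ} ∩
      ⋂ (σ : Equiv.Perm (Fin d)) (x : Fin d → ℝ≥0), {ℓ | ℓ (fun i => x (σ i)) = ℓ x} := by
    ext ℓ; simp [symmetricTailFunctions]
  rw [h]
  refine (isClosed_isStableTailDependenceFunction d).inter ?_
  exact isClosed_iInter fun σ => isClosed_iInter fun x =>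
    isClosed_eq (continuous_apply _) (continuous_apply _)

theorem convexHull_range_tail_subset (d : ℕ) [NeZero d] :
    convexHull ℝ (Set.range (PermClass.tail (d := d))) ⊆ symmetricTailFunctions d := by
  intro ℓ hℓ
  rw [_root_.convexHull_eq] at hℓ
  obtain ⟨ι, t, a, z, ha, hsum, hz, rfl⟩ := hℓ
  have : Nonempty (PermClass d) := ⟨PermClass.mk (Classical.arbitrary _)⟩
  choose! c hc using hz
  choose q hq using fun k => PermClass.mk_surjective (c k)
  have hz' : ∀ k ∈ t, z k = permTail (q k) := fun k hk => by
    rw [← hc k hk, ← hq k, PermClass.tail_mk]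
  have heq : t.centerMass a z = fun x => ∑ k ∈ t, a k * permTail (q k) x := by
    rw [Finset.centerMass_eq_of_sum_1 _ _ hsum]
    funext x
    rw [Finset.sum_apply]
    exact Finset.sum_congr rfl fun k hk => by simp [hz' k hk]
  rw [heq]
  refine ⟨?_, fun σ x => by simp only [permTail_comp_perm]⟩
  have hf : ((d - 1).factorial : ℝ) ≠ 0 := Nat.cast_ne_zero.2 (Nat.factorial_ne_zero _)
  have := isStableTailDependenceFunction_sum_iSup (d := d) (κ := t × Equiv.Perm (Fin d))
    (fun k i => a k.1 / ((d - 1).factorial : ℝ) * (q k.1 : Fin d → ℝ) (k.2 i))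
    (fun k i => mul_nonneg (div_nonneg (ha _ k.1.2) (by positivity)) ((q k.1).2.1 _))
    (fun i => by
      rw [Fintype.sum_prod_type]
      simp only [← Finset.mul_sum, sum_perm_apply, div_mul_cancel₀ _ hf]
      rw [Finset.sum_coe_sort t a, hsum])
  convert this using 2 with x
  rw [Fintype.sum_prod_type, ← Finset.sum_coe_sort t]
  refine Finset.sum_congr rfl fun k _ => ?_
  unfold permTail
  rw [Finset.mul_sum, Finset.mul_sum]
  refine Finset.sum_congr rfl fun σ _ => ?_
  rw [← mul_assoc, Real.mul_iSup_of_nonneg (by have := ha _ k.2; positivity)]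
  congr 1 with i
  ring

/-- Every mixture of the functions `permTail q` is a symmetric stable tail dependence function:
finite mixtures are, and on finitely many arguments a general mixture is approximated by finite
ones. -/
theorem integral_tail_mem {d : ℕ} [NeZero d] (ν : Measure (PermClass d)) [IsProbabilityMeasure ν] :
    (fun x => ∫ c, c.tail x ∂ν) ∈ symmetricTailFunctions d := by
  refine (isClosed_symmetricTailFunctions d).closure_subset_iff.2
    (convexHull_range_tail_subset d) ?_
  set g : (Fin d → ℝ≥0) → ℝ := fun x => ∫ c, c.tail x ∂ν
  rw [mem_closure_iff_nhds]
  intro U hU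
  rw [nhds_pi, Filter.mem_pi'] at hU
  obtain ⟨F, V, hV, hVU⟩ := hU
  let ρ : ((Fin d → ℝ≥0) → ℝ) →ₗ[ℝ] (F → ℝ) := LinearMap.pi fun x => LinearMap.proj (x : Fin d → ℝ≥0)
  have hmem : ρ g ∈ closure (ρ '' convexHull ℝ (Set.range (PermClass.tail (d := d)))) := by
    have h1 := Convex.integral_mem (μ := ν) (f := fun c => ρ c.tail)
      ((convex_convexHull ℝ (Set.range (PermClass.tail (d := d)))).linear_image ρ).closure
      isClosed_closure (ae_of_all _ fun c => subset_closure
        (mem_image_of_mem _ (subset_convexHull ℝ _ (mem_range_self c))))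
      (PermClass.integrable_tail ν F)
    have h2 : ∫ c, ρ c.tail ∂ν = ρ g := by
      funext x
      exact eval_integral (fun x : F => PermClass.integrable_tail_apply ν x) x
    rwa [h2] at h1
  obtain ⟨_, hy, ℓ, hℓ, rfl⟩ := mem_closure_iff_nhds.1 hmem (Set.pi univ fun x : F => V x)
    (set_pi_mem_nhds finite_univ fun x _ => hV x)
  exact ⟨ℓ, hVU fun x hx => hy ⟨x, hx⟩ (mem_univ _), hℓ⟩

/-! ### Spectral representation -/

/-- Two nonnegative random variables with the same distribution function on `(0, ∞)` have the same
expectation. -/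
theorem lintegral_ofReal_eq_of_measure_le_eq {Ω Ω' : Type*} [MeasurableSpace Ω]
    [MeasurableSpace Ω'] {μ : Measure Ω} {μ' : Measure Ω'} [IsProbabilityMeasure μ]
    [IsProbabilityMeasure μ'] {f : Ω → ℝ} {g : Ω' → ℝ} (hf : Measurable f) (hg : Measurable g)
    (hf0 : ∀ ω, 0 ≤ f ω) (hg0 : ∀ ω, 0 ≤ g ω)
    (h : ∀ t : ℝ, 0 < t → μ {ω | f ω ≤ t} = μ' {ω | g ω ≤ t}) :
    ∫⁻ ω, ENNReal.ofReal (f ω) ∂μ = ∫⁻ ω, ENNReal.ofReal (g ω) ∂μ' := by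
  rw [lintegral_eq_lintegral_meas_lt μ (ae_of_all _ hf0) hf.aemeasurable,
    lintegral_eq_lintegral_meas_lt μ' (ae_of_all _ hg0) hg.aemeasurable]
  refine setLIntegral_congr_fun measurableSet_Ioi fun t ht => ?_
  have h1 : {ω | t < f ω} = {ω | f ω ≤ t}ᶜ := by ext; simp
  have h2 : {ω | t < g ω} = {ω | g ω ≤ t}ᶜ := by ext; simp
  rw [h1, h2, prob_compl_eq_one_sub (measurableSet_le hf measurable_const),
    prob_compl_eq_one_sub (measurableSet_le hg measurable_const), h t ht]

theorem mul_abs_log_rpow_neg_le_iff {u x t α : ℝ} (hu : u ∈ Ioo (0 : ℝ) 1) (hx : 0 ≤ x)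
    (ht : 0 < t) (hα : 0 < α) :
    x * |Real.log u| ^ (-α) ≤ t ↔ u ≤ Real.exp (-(x / t) ^ α⁻¹) := by
  have hy : 0 < |Real.log u| := abs_pos.2 (Real.log_neg hu.1 hu.2).ne
  have hpos : 0 < |Real.log u| ^ α := Real.rpow_pos_of_pos hy α
  rw [Real.rpow_neg hy.le, ← div_eq_mul_inv, div_le_iff₀ hpos, ← div_le_iff₀' ht,
    ← Real.rpow_inv_le_iff_of_pos (by positivity) hy.le hα, ← Real.log_le_iff_le_exp hu.1,
    abs_of_neg (Real.log_neg hu.1 hu.2)]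
  exact le_neg

/-- The expectation `Γ(1 - α)` of `E⁻ᵅ` for a standard exponential variable `E = |log V|`,
where `V` is uniform. -/
noncomputable def logMoment (α : ℝ) : ENNReal :=
  ∫⁻ v, ENNReal.ofReal (|Real.log v| ^ (-α)) ∂(volume : Measure ℝ).restrict (Icc 0 1)

theorem measurable_abs_log_rpow (α : ℝ) : Measurable fun v : ℝ => |Real.log v| ^ (-α) :=
  (continuous_abs.measurable.comp Real.measurable_log).pow_const _

theorem logMoment_ne_top {α : ℝ} (hα0 : 0 < α) (hα : α < 1) : logMoment α ≠ ⊤ := by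
  have h1 : IntervalIntegrable (fun v : ℝ => (1 - v) ^ (-α)) volume 0 1 := by
    have := (intervalIntegral.intervalIntegrable_rpow' (a := 1) (b := 0)
      (r := -α) (by linarith)).comp_sub_left 1
    simpa using this
  have h2 : IntegrableOn (fun v : ℝ => (1 - v) ^ (-α)) (Ioo 0 1) := by
    rwa [intervalIntegrable_iff_integrableOn_Ioo_of_le zero_le_one] at h1
  rw [logMoment, ← restrict_Ioo_eq_restrict_Icc]
  refine (lt_of_le_of_lt (setLIntegral_mono' measurableSet_Ioo fun v hv => ?_)
    h2.lintegral_lt_top).ne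
  refine ENNReal.ofReal_le_ofReal (Real.rpow_le_rpow_of_nonpos (by linarith [hv.2]) ?_ (by linarith))
  rw [abs_of_neg (Real.log_neg hv.1 hv.2)]
  linarith [Real.log_le_sub_one_of_pos hv.1]

theorem logMoment_ne_zero (α : ℝ) : logMoment α ≠ 0 := by
  intro h
  rw [logMoment, lintegral_eq_zero_iff (measurable_abs_log_rpow α).ennreal_ofReal,
    ← restrict_Ioo_eq_restrict_Icc] at h
  have h2 : ∀ᵐ v ∂(volume : Measure ℝ).restrict (Ioo 0 1), False := by
    filter_upwards [h, ae_restrict_mem measurableSet_Ioo] with v hv hv01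
    have hy : 0 < |Real.log v| := abs_pos.2 (Real.log_neg hv01.1 hv01.2).ne
    simp only [Pi.zero_apply, ENNReal.ofReal_eq_zero] at hv
    exact absurd (Real.rpow_pos_of_pos hy (-α)) (not_lt.2 hv)
  have h3 := measure_mono_null (fun x _ => by simp : univ ⊆ {x : ℝ | ¬ False}) h2
  simp at h3

section Spectral

variable {d : ℕ} {ℓ : (Fin d → ℝ≥0) → ℝ} {μ : Measure (Fin d → ℝ)}

/-- If `u` has the distribution function `exp (-ℓ)` in exponential coordinates, then
`maxᵢ xᵢ |log uᵢ|⁻ᵅ` is distributed as `ℓ(x ^ (1/α)) ^ α * E⁻ᵅ` with a standard exponential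
variable `E`. This identifies its expectation. -/
theorem lintegral_iSup_mul_abs_log_rpow [IsProbabilityMeasure μ]
    (hom : ∀ (t : ℝ≥0) (x : Fin d → ℝ≥0), ℓ (fun i => t * x i) = t * ℓ x)
    (hmarg : ∀ i, μ.map (fun u => u i) = (volume : Measure ℝ).restrict (Icc 0 1))
    (hexp : ∀ x : Fin d → ℝ≥0, μ.real (Iic fun i => Real.exp (-(x i : ℝ))) = Real.exp (-ℓ x))
    {α : ℝ} (hα : 0 < α) (x : Fin d → ℝ≥0) :
    ∫⁻ u, ENNReal.ofReal (⨆ i, (x i : ℝ) * |Real.log (u i)| ^ (-α)) ∂μ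
      = ENNReal.ofReal (ℓ (fun i => x i ^ α⁻¹) ^ α) * logMoment α := by
  set L := ℓ fun i => x i ^ α⁻¹ with hL
  have hL0 : 0 ≤ L := by
    have h1 : Real.exp (-L) ≤ 1 := by rw [hL, ← hexp]; exact measureReal_le_one
    rw [Real.exp_le_one_iff] at h1
    linarith
  rw [logMoment, ← lintegral_const_mul _ (measurable_abs_log_rpow α).ennreal_ofReal]
  simp_rw [← ENNReal.ofReal_mul (Real.rpow_nonneg hL0 α)]
  refine lintegral_ofReal_eq_of_measure_le_eq (Measurable.iSup fun i => ?_)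
    ((measurable_abs_log_rpow α).const_mul _)
    (fun u => Real.iSup_nonneg fun i => by positivity) (fun v => by positivity) fun t ht => ?_
  · exact ((measurable_abs_log_rpow α).comp (measurable_pi_apply i)).const_mul _
  set s : ℝ≥0 := (t.toNNReal)⁻¹ ^ α⁻¹ with hs
  have hst : (s : ℝ) = t⁻¹ ^ α⁻¹ := by
    rw [hs, NNReal.coe_rpow, NNReal.coe_inv, Real.coe_toNNReal t ht.le]
  have h1 : μ {u | ⨆ i, (x i : ℝ) * |Real.log (u i)| ^ (-α) ≤ t}
      = μ (Iic fun i => Real.exp (-((s * x i ^ α⁻¹ : ℝ≥0) : ℝ))) := by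
    refine measure_congr ?_
    filter_upwards [ae_mem_cube_of_uniform hmarg] with u hu
    refine propext ((Real.iSup_le_iff_of_nonneg ht.le).trans (forall_congr' fun i => ?_))
    have hxi : (((s * x i ^ α⁻¹ : ℝ≥0) : ℝ)) = ((x i : ℝ) / t) ^ α⁻¹ := by
      rw [NNReal.coe_mul, hst, NNReal.coe_rpow, div_eq_inv_mul,
        Real.mul_rpow (by positivity) (NNReal.coe_nonneg _)]
    simp only [hxi]
    exact mul_abs_log_rpow_neg_le_iff (hu i) (NNReal.coe_nonneg _) ht hα
  have h2 : (volume : Measure ℝ).restrict (Icc 0 1) {v | L ^ α * |Real.log v| ^ (-α) ≤ t}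
      = (volume : Measure ℝ).restrict (Icc 0 1) (Iic (Real.exp (-(s * L)))) := by
    refine measure_congr ?_
    have hlam : ∀ᵐ v ∂(volume : Measure ℝ).restrict (Icc 0 1), v ∈ Ioo (0 : ℝ) 1 := by
      rw [← restrict_Ioo_eq_restrict_Icc]
      exact ae_restrict_mem measurableSet_Ioo
    filter_upwards [hlam] with v hv
    refine propext ((mul_abs_log_rpow_neg_le_iff hv (by positivity) ht hα).trans ?_)
    rw [hst, div_eq_inv_mul, Real.mul_rpow (by positivity) (by positivity),
      Real.rpow_rpow_inv hL0 hα.ne']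
    rfl
  rw [h1, h2, uniform_Iic_exp (by positivity), ← ofReal_measureReal, hexp fun i => s * x i ^ α⁻¹,
    hom]

/-- The normalization to the unit simplex of the vector with coordinates `|log uᵢ|⁻ᵅ`; an arbitrary
point of the simplex where this vector vanishes. -/
noncomputable def logDirection [NeZero d] (α : ℝ) (u : Fin d → ℝ) : stdSimplex ℝ (Fin d) := by
  classical
  exact if h : ∑ i, |Real.log (u i)| ^ (-α) = 0 then Classical.arbitrary _ else
    ⟨fun i => |Real.log (u i)| ^ (-α) / ∑ j, |Real.log (u j)| ^ (-α),
      fun i => by positivity, by rw [← Finset.sum_div, div_self h]⟩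

theorem measurable_sum_abs_log_rpow (α : ℝ) :
    Measurable fun u : Fin d → ℝ => ∑ i, |Real.log (u i)| ^ (-α) :=
  Finset.measurable_sum _ fun i _ => (measurable_abs_log_rpow α).comp (measurable_pi_apply i)

theorem measurable_logDirection [NeZero d] (α : ℝ) :
    Measurable (logDirection α : (Fin d → ℝ) → stdSimplex ℝ (Fin d)) := by
  classical
  have hcoe : (fun u : Fin d → ℝ => (logDirection α u : Fin d → ℝ)) = fun u =>
      if ∑ i, |Real.log (u i)| ^ (-α) = 0
        then ((Classical.arbitrary (stdSimplex ℝ (Fin d)) : stdSimplex ℝ (Fin d)) : Fin d → ℝ)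
        else fun i => |Real.log (u i)| ^ (-α) / ∑ j, |Real.log (u j)| ^ (-α) := by
    funext u
    unfold logDirection
    split_ifs <;> rfl
  refine Measurable.subtype_mk (f := fun u => (logDirection α u : Fin d → ℝ))
    (h := fun u => (logDirection α u).2) ?_
  rw [hcoe]
  refine Measurable.ite (measurable_sum_abs_log_rpow α (measurableSet_singleton 0))
    measurable_const (measurable_pi_lambda _ fun i => Measurable.div ?_
      (measurable_sum_abs_log_rpow α))
  exact (measurable_abs_log_rpow α).comp (measurable_pi_apply i)

theorem sum_abs_log_rpow_mul_permTail [NeZero d] (α : ℝ) (u : Fin d → ℝ) (x : Fin d → ℝ≥0) :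
    (∑ i, |Real.log (u i)| ^ (-α)) * permTail (logDirection α u) x =
      1 / ((d - 1).factorial : ℝ) * ∑ σ : Equiv.Perm (Fin d),
        ⨆ i, (x (σ i) : ℝ) * |Real.log (u i)| ^ (-α) := by
  classical
  unfold permTail
  have hS0 : 0 ≤ ∑ i, |Real.log (u i)| ^ (-α) := Finset.sum_nonneg fun i _ => by positivity
  rw [mul_left_comm, Finset.mul_sum, ← Equiv.sum_comp (Equiv.inv (Equiv.Perm (Fin d)))]
  congr 1
  refine Finset.sum_congr rfl fun σ _ => ?_
  rw [Real.mul_iSup_of_nonneg hS0, ← Equiv.iSup_comp (g := fun i => _ * ((x i : ℝ) * _)) σ]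
  congr 1 with i
  by_cases h : ∑ i, |Real.log (u i)| ^ (-α) = 0
  · have hi := (Finset.sum_eq_zero_iff_of_nonneg fun i _ => by positivity).1 h i (Finset.mem_univ i)
    rw [h, hi]; simp
  · have hσ : (Equiv.inv (Equiv.Perm (Fin d)) σ) (σ i) = i := Equiv.symm_apply_apply σ i
    have hq : (logDirection α u : Fin d → ℝ) i
        = |Real.log (u i)| ^ (-α) / ∑ j, |Real.log (u j)| ^ (-α) := by
      simp only [logDirection, h, dite_false]
      rfl
    rw [hσ, hq]
    field_simp

/-- The outer power `x ↦ ℓ(x ^ (1/α)) ^ α` of a symmetric stable tail dependence function is a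
mixture of the functions `permTail q`. The mixing measure is the law of the normalization of
`|log u|⁻ᵅ` under the density proportional to the sum of the coordinates of `|log u|⁻ᵅ`. -/
theorem exists_measure_integral_tail_eq_rpow [NeZero d] (hℓ : ℓ ∈ symmetricTailFunctions d) {α : ℝ}
    (hα0 : 0 < α) (hα1 : α < 1) :
    ∃ ν : Measure (PermClass d), IsProbabilityMeasure ν ∧
      ∀ x, ∫ c, c.tail x ∂ν = ℓ (fun i => x i ^ α⁻¹) ^ α := by
  obtain ⟨hstdf, hsymm⟩ := hℓ
  obtain ⟨hom, -, μ, hprob, hmarg, hexp⟩ := hstdf.exists_law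
  have hnonneg : ∀ x, 0 ≤ ℓ x := by
    intro x
    have h1 : Real.exp (-ℓ x) ≤ 1 := by rw [← hexp]; exact measureReal_le_one
    rw [Real.exp_le_one_iff] at h1
    linarith
  set c := logMoment α with hc
  have hc0 : c ≠ 0 := logMoment_ne_zero α
  have hct : c ≠ ⊤ := logMoment_ne_top hα0 hα1
  have hd0 : (d : ENNReal) ≠ 0 := Nat.cast_ne_zero.2 (NeZero.ne d)
  have hdt : (d : ENNReal) ≠ ⊤ := ENNReal.natCast_ne_top d
  let S : (Fin d → ℝ) → ℝ := fun u => ∑ i, |Real.log (u i)| ^ (-α)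
  have hS0 : ∀ u, 0 ≤ S u := fun u => Finset.sum_nonneg fun i _ => by positivity
  have hSm : Measurable S := measurable_sum_abs_log_rpow α
  have hSint : ∫⁻ u, ENNReal.ofReal (S u) ∂μ = d * c := by
    simp_rw [S, ENNReal.ofReal_sum_of_nonneg fun i (_ : i ∈ Finset.univ) =>
      Real.rpow_nonneg (abs_nonneg (Real.log _)) (-α)]
    have hm : ∀ i : Fin d, Measurable fun u : Fin d → ℝ =>
        ENNReal.ofReal (|Real.log (u i)| ^ (-α)) := fun i =>
      ((measurable_abs_log_rpow α).comp (measurable_pi_apply i)).ennreal_ofReal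
    rw [lintegral_finsetSum _ fun i _ => hm i]
    have : ∀ i, ∫⁻ u, ENNReal.ofReal (|Real.log (u i)| ^ (-α)) ∂μ = c := fun i => by
      rw [hc, logMoment, ← hmarg i, lintegral_map (measurable_abs_log_rpow α).ennreal_ofReal
        (measurable_pi_apply i)]
    simp [this]
  have hmk : Measurable fun u : Fin d → ℝ => PermClass.mk (logDirection α u) :=
    PermClass.continuous_mk.measurable.comp (measurable_logDirection α)
  refine ⟨((d * c)⁻¹ • μ.withDensity fun u => ENNReal.ofReal (S u)).map
    fun u => PermClass.mk (logDirection α u), ⟨?_⟩, fun x => ?_⟩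
  · rw [Measure.map_apply hmk MeasurableSet.univ, preimage_univ, Measure.smul_apply,
      withDensity_apply _ MeasurableSet.univ, Measure.restrict_univ, hSint, smul_eq_mul,
      ENNReal.inv_mul_cancel (mul_ne_zero hd0 hc0) (ENNReal.mul_ne_top hdt hct)]
  have hterm : ∀ σ : Equiv.Perm (Fin d),
      ∫⁻ u, ENNReal.ofReal (⨆ i, (x (σ i) : ℝ) * |Real.log (u i)| ^ (-α)) ∂μ
        = ENNReal.ofReal (ℓ (fun i => x i ^ α⁻¹) ^ α) * c := fun σ => by
    rw [lintegral_iSup_mul_abs_log_rpow hom hmarg hexp hα0 fun i => x (σ i),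
      hsymm σ fun i => x i ^ α⁻¹]
  have hmeas : ∀ σ : Equiv.Perm (Fin d),
      Measurable fun u : Fin d → ℝ => ⨆ i, (x (σ i) : ℝ) * |Real.log (u i)| ^ (-α) := fun σ =>
    Measurable.iSup fun i =>
      ((measurable_abs_log_rpow α).comp (measurable_pi_apply i)).const_mul _
  have hpos : ∀ (σ : Equiv.Perm (Fin d)) (u : Fin d → ℝ),
      0 ≤ ⨆ i, (x (σ i) : ℝ) * |Real.log (u i)| ^ (-α) := fun σ u =>
    Real.iSup_nonneg fun i => by positivity
  have hint : ∀ σ : Equiv.Perm (Fin d),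
      Integrable (fun u : Fin d → ℝ => ⨆ i, (x (σ i) : ℝ) * |Real.log (u i)| ^ (-α)) μ := by
    refine fun σ => ⟨(hmeas σ).aestronglyMeasurable, ?_⟩
    rw [hasFiniteIntegral_iff_ofReal (ae_of_all _ (hpos σ)), hterm σ]
    exact ENNReal.mul_lt_top ENNReal.ofReal_lt_top hct.lt_top
  rw [integral_map hmk.aemeasurable
    (PermClass.continuous_tail_apply x).measurable.aestronglyMeasurable, integral_smul_measure,
    integral_withDensity_eq_integral_toReal_smul hSm.ennreal_ofReal (by simp)]
  simp_rw [PermClass.tail_mk, ENNReal.toReal_ofReal (hS0 _), smul_eq_mul]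
  simp only [S, sum_abs_log_rpow_mul_permTail]
  rw [integral_const_mul, integral_finsetSum _ fun σ _ => hint σ]
  have hval : ∀ σ : Equiv.Perm (Fin d),
      ∫ u, ⨆ i, (x (σ i) : ℝ) * |Real.log (u i)| ^ (-α) ∂μ
        = ℓ (fun i => x i ^ α⁻¹) ^ α * c.toReal := fun σ => by
    rw [integral_eq_lintegral_of_nonneg_ae (ae_of_all _ (hpos σ)) (hmeas σ).aestronglyMeasurable,
      hterm σ, ENNReal.toReal_mul, ENNReal.toReal_ofReal (Real.rpow_nonneg (hnonneg _) _)]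
  have hc' : c.toReal ≠ 0 := ENNReal.toReal_ne_zero.2 ⟨hc0, hct⟩
  have hf : ((d - 1).factorial : ℝ) ≠ 0 := Nat.cast_ne_zero.2 (Nat.factorial_ne_zero _)
  have hd' : (d : ℝ) ≠ 0 := Nat.cast_ne_zero.2 (NeZero.ne d)
  simp only [hval, Finset.sum_const, Finset.card_univ, Fintype.card_perm, Fintype.card_fin,
    nsmul_eq_mul]
  rw [← Nat.mul_factorial_pred (NeZero.ne d), ENNReal.toReal_inv, ENNReal.toReal_mul,
    ENNReal.toReal_natCast, Nat.cast_mul]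
  field_simp

end Spectral

/-- The set of mixtures of the functions `permTail q` is compact, as an image of the compact space
of probability measures on the compact space of classes. -/
theorem isCompact_range_integral_tail (d : ℕ) :
    IsCompact (Set.range fun (P : ProbabilityMeasure (PermClass d)) (x : Fin d → ℝ≥0) =>
      ∫ c, c.tail x ∂(P : Measure (PermClass d))) := by
  refine isCompact_range (continuous_pi fun x => ?_)
  exact ProbabilityMeasure.continuous_integral_continuousMap
    (⟨fun c : PermClass d => c.tail x, PermClass.continuous_tail_apply x⟩ : C(PermClass d, ℝ))

/-- A stable tail dependence function is continuous, because a distribution function with uniform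
margins is. -/
theorem IsStableTailDependenceFunction.continuous {d : ℕ} {ℓ : (Fin d → ℝ≥0) → ℝ}
    (h : IsStableTailDependenceFunction ℓ) : Continuous ℓ := by
  obtain ⟨-, -, μ, hprob, hmarg, hexp⟩ := h.exists_law
  have hle : ∀ a b : Fin d → ℝ, μ.real (Iic a) ≤ μ.real (Iic b) + ∑ i, |a i - b i| := by
    intro a b
    have hsub : Iic a ⊆ Iic b ∪ ⋃ i, (fun u : Fin d → ℝ => u i) ⁻¹' Ioc (b i) (a i) := by
      intro u hu
      by_cases hub : u ∈ Iic b
      · exact Or.inl hub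
      · simp only [mem_Iic, Pi.le_def, not_forall, not_le] at hub
        obtain ⟨i, hi⟩ := hub
        exact Or.inr (mem_iUnion.2 ⟨i, hi, hu i⟩)
    refine (measureReal_mono hsub).trans ((measureReal_union_le _ _).trans
      (add_le_add_right ((measureReal_iUnion_fintype_le _).trans
        (Finset.sum_le_sum fun i _ => ?_)) _))
    rw [Measure.real, ← Measure.map_apply (measurable_pi_apply i) measurableSet_Ioc, hmarg i]
    refine ENNReal.toReal_le_of_le_ofReal (abs_nonneg _)
      ((Measure.restrict_apply_le _ _).trans ?_)
    rw [Real.volume_Ioc]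
    exact ENNReal.ofReal_le_ofReal (le_abs_self _)
  have hcont : Continuous fun a : Fin d → ℝ => μ.real (Iic a) := by
    refine continuous_iff_continuousAt.2 fun a => ?_
    refine tendsto_iff_dist_tendsto_zero.2 (squeeze_zero (fun _ => dist_nonneg)
      (g := fun b => ∑ i, |b i - a i|) (fun b => ?_) ?_)
    · rw [Real.dist_eq, abs_le]
      have h1 := hle a b
      simp_rw [abs_sub_comm (a _)] at h1
      constructor <;> linarith [hle b a]
    · have : Continuous fun b : Fin d → ℝ => ∑ i, |b i - a i| := by fun_prop
      simpa using this.tendsto a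
  have hℓ : ℓ = fun x => -Real.log (μ.real (Iic fun i => Real.exp (-(x i : ℝ)))) := by
    funext x
    rw [hexp, Real.log_exp, neg_neg]
  rw [hℓ]
  refine (Continuous.log (hcont.comp (by fun_prop)) fun x => ?_).neg
  exact ((hexp x).trans_gt (Real.exp_pos _)).ne'

/-- Spectral representation: a symmetric stable tail dependence function is a mixture of the
functions `permTail q`. Its outer powers are, and converge to it as the exponent tends to one. -/
theorem exists_measure_integral_tail_eq {d : ℕ} [NeZero d] {ℓ : (Fin d → ℝ≥0) → ℝ}
    (hℓ : ℓ ∈ symmetricTailFunctions d) :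
    ∃ ν : Measure (PermClass d), IsProbabilityMeasure ν ∧ ∀ x, ℓ x = ∫ c, c.tail x ∂ν := by
  have hlim : Tendsto (fun (α : ℝ) (x : Fin d → ℝ≥0) => ℓ (fun i => x i ^ α⁻¹) ^ α) (𝓝[<] 1)
      (𝓝 ℓ) := by
    refine tendsto_pi_nhds.2 fun x => Tendsto.mono_left ?_ nhdsWithin_le_nhds
    have h1 : ContinuousAt (fun α : ℝ => ℓ (fun i => x i ^ α⁻¹)) 1 := by
      refine hℓ.1.continuous.continuousAt.comp (continuousAt_pi.2 fun i => ?_)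
      exact ContinuousAt.comp (g := fun p : ℝ≥0 × ℝ => p.1 ^ p.2) (f := fun α : ℝ => (x i, α⁻¹))
        (NNReal.continuousAt_rpow (Or.inr (by norm_num)))
        (continuousAt_const.prodMk (continuousAt_inv₀ one_ne_zero))
    have h2 := (h1.rpow continuousAt_id (Or.inr one_pos)).tendsto
    simpa using h2
  have hmem : ℓ ∈ Set.range fun (P : ProbabilityMeasure (PermClass d)) (x : Fin d → ℝ≥0) =>
      ∫ c, c.tail x ∂(P : Measure (PermClass d)) := by
    refine (isCompact_range_integral_tail d).isClosed.mem_of_tendsto hlim ?_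
    filter_upwards [Ioo_mem_nhdsLT (zero_lt_one' ℝ)] with α hα
    obtain ⟨ν, hν, hνx⟩ := exists_measure_integral_tail_eq_rpow hℓ hα.1 hα.2
    exact ⟨⟨ν, hν⟩, funext hνx⟩
  obtain ⟨P, hP⟩ := hmem
  exact ⟨P, P.2, fun x => (congrFun hP x).symm⟩

/-! ### Uniqueness of the spectral measure on the simplex -/

theorem generateFrom_range_Iic_pi (d : ℕ) :
    MeasurableSpace.generateFrom (Set.range fun t : Fin d → ℝ => Iic t) = MeasurableSpace.pi := by
  have h := generateFrom_eq_pi (ι := Fin d) (α := fun _ => ℝ) (C := fun _ => Set.range Iic)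
    (fun _ => (borel_eq_generateFrom_Iic ℝ).symm.trans (BorelSpace.measurable_eq (α := ℝ)).symm)
    (fun _ => ⟨fun n : ℕ => Iic (n : ℝ), fun n => mem_range_self _, by
      refine eq_univ_of_forall fun y => ?_
      obtain ⟨n, hn⟩ := exists_nat_ge y
      exact mem_iUnion.2 ⟨n, hn⟩⟩)
  rw [← h]
  congr 1
  ext s
  constructor
  · rintro ⟨t, rfl⟩
    exact ⟨fun i => Iic (t i), fun i _ => mem_range_self _, pi_univ_Iic t⟩
  · rintro ⟨A, hA, rfl⟩
    choose t ht using fun i => hA i (mem_univ i)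
    refine ⟨t, ?_⟩
    simp only [← pi_univ_Iic, ht]

/-- A finite measure on `[0, ∞)^d` is determined by its distribution function on `(0, ∞)^d`. -/
theorem MeasureTheory.Measure.ext_of_Iic_pos {d : ℕ} {μ ν : Measure (Fin d → ℝ)} [IsFiniteMeasure μ]
    [IsFiniteMeasure ν] (hμ : ∀ᵐ y ∂μ, ∀ i, 0 ≤ y i) (hν : ∀ᵐ y ∂ν, ∀ i, 0 ≤ y i)
    (h : ∀ t : Fin d → ℝ, (∀ i, 0 < t i) → μ (Iic t) = ν (Iic t)) : μ = ν := by
  have hnonneg : ∀ t : Fin d → ℝ, (∀ i, 0 ≤ t i) → μ (Iic t) = ν (Iic t) := by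
    intro t ht
    have hI : Iic t = ⋂ n : ℕ, Iic fun i => t i + 1 / ((n : ℝ) + 1) := by
      ext y
      simp only [mem_Iic, mem_iInter, Pi.le_def]
      refine ⟨fun hy n i => (hy i).trans (le_add_of_nonneg_right (by positivity)), fun hy i => ?_⟩
      have hl : Tendsto (fun n : ℕ => t i + 1 / ((n : ℝ) + 1)) atTop (𝓝 (t i)) := by
        simpa using (tendsto_one_div_add_atTop_nhds_zero_nat (𝕜 := ℝ)).const_add (t i)
      exact ge_of_tendsto' hl fun n => hy n i
    have hanti : Antitone fun n : ℕ => Iic fun i => t i + 1 / ((n : ℝ) + 1) := by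
      intro n m hnm
      refine Iic_subset_Iic.2 fun i => ?_
      have : (n : ℝ) ≤ m := Nat.cast_le.2 hnm
      simp only
      gcongr
    have hl : ∀ (ρ : Measure (Fin d → ℝ)) [IsFiniteMeasure ρ], Tendsto
        (fun n : ℕ => ρ (Iic fun i => t i + 1 / ((n : ℝ) + 1))) atTop (𝓝 (ρ (Iic t))) := by
      intro ρ _
      rw [hI]
      exact tendsto_measure_iInter_atTop (fun n => measurableSet_Iic.nullMeasurableSet) hanti
        ⟨0, measure_ne_top _ _⟩
    refine tendsto_nhds_unique (hl μ) ((hl ν).congr fun n => (h _ fun i => ?_).symm)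
    have := ht i
    positivity
  have hall : ∀ t : Fin d → ℝ, μ (Iic t) = ν (Iic t) := by
    intro t
    by_cases ht : ∀ i, 0 ≤ t i
    · exact hnonneg t ht
    · push Not at ht
      obtain ⟨i, hi⟩ := ht
      have hz : ∀ ρ : Measure (Fin d → ℝ), (∀ᵐ y ∂ρ, ∀ i, 0 ≤ y i) → ρ (Iic t) = 0 := by
        intro ρ hρ
        refine measure_mono_null (fun y (hy : y ≤ t) => ?_) (ae_iff.1 hρ)
        exact fun h => absurd (h i) (not_le.2 ((hy i).trans_lt hi))
      rw [hz μ hμ, hz ν hν]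
  have huniv : μ univ = ν univ := by
    have hU : (univ : Set (Fin d → ℝ)) = ⋃ n : ℕ, Iic fun _ => (n : ℝ) := by
      refine (eq_univ_of_forall fun y => ?_).symm
      obtain ⟨n, hn⟩ := exists_nat_ge (∑ i, |y i|)
      exact mem_iUnion.2 ⟨n, fun i => (le_abs_self _).trans
        ((Finset.single_le_sum (f := fun i => |y i|) (fun i _ => abs_nonneg _)
          (Finset.mem_univ i)).trans hn)⟩
    have hmono : Monotone fun n : ℕ => Iic fun _ : Fin d => (n : ℝ) := fun n m hnm =>
      Iic_subset_Iic.2 fun _ => Nat.cast_le.2 hnm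
    rw [hU]
    exact tendsto_nhds_unique (tendsto_measure_iUnion_atTop hmono)
      ((tendsto_measure_iUnion_atTop hmono).congr fun n => (hall _).symm)
  refine ext_of_generate_finite _ (generateFrom_range_Iic_pi d).symm ?_ ?_ huniv
  · rintro _ ⟨s, rfl⟩ _ ⟨t, rfl⟩ -
    exact ⟨s ⊓ t, Iic_inter_Iic.symm⟩
  · rintro _ ⟨t, rfl⟩
    exact hall t

section Uniqueness

variable {d : ℕ}

theorem stdSimplex_nonneg (q : stdSimplex ℝ (Fin d)) (i : Fin d) : 0 ≤ (q : Fin d → ℝ) i := q.2.1 i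

theorem stdSimplex_le_one (q : stdSimplex ℝ (Fin d)) (i : Fin d) : (q : Fin d → ℝ) i ≤ 1 := by
  rw [← q.2.2]
  exact Finset.single_le_sum (f := fun i => (q : Fin d → ℝ) i) (fun i _ => q.2.1 i)
    (Finset.mem_univ i)

theorem iSup_update_mul (x : Fin d → ℝ≥0) (j : Fin d) (ε : ℝ≥0) (q : stdSimplex ℝ (Fin d)) :
    ⨆ i, (Function.update x j (x j + ε) i : ℝ) * (q : Fin d → ℝ) i =
      max (⨆ i, (x i : ℝ) * (q : Fin d → ℝ) i) ((x j + ε) * (q : Fin d → ℝ) j) := by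
  have : Nonempty (Fin d) := ⟨j⟩
  have hle : ∀ (y : Fin d → ℝ≥0) i,
      (y i : ℝ) * (q : Fin d → ℝ) i ≤ ⨆ i, (y i : ℝ) * (q : Fin d → ℝ) i := fun y i =>
    le_ciSup (f := fun i => (y i : ℝ) * (q : Fin d → ℝ) i) (Set.finite_range _).bddAbove i
  refine le_antisymm (ciSup_le fun i => ?_) (max_le (ciSup_le fun i => ?_) ?_)
  · rcases eq_or_ne i j with rfl | hij
    · exact le_max_of_le_right (by simp)
    · exact le_max_of_le_left (by simpa [hij] using hle x i)
  · refine le_trans (mul_le_mul_of_nonneg_right ?_ (stdSimplex_nonneg q i)) (hle _ i)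
    rcases eq_or_ne i j with rfl | hij
    · simp
    · simp [hij]
  · refine le_trans (le_of_eq ?_) (hle _ j)
    simp

/-- The right derivative of `x ↦ maxᵢ xᵢ qᵢ` in the direction of the coordinate `j` is `qⱼ` where
the maximum is attained at `j`, and zero elsewhere. -/
theorem tendsto_slope_iSup (x : Fin d → ℝ≥0) (j : Fin d) (q : stdSimplex ℝ (Fin d)) :
    Tendsto (fun n : ℕ => ((n : ℝ) + 1) *
      ((⨆ i, (Function.update x j (x j + 1 / ((n : ℝ≥0) + 1)) i : ℝ) * (q : Fin d → ℝ) i) -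
        ⨆ i, (x i : ℝ) * (q : Fin d → ℝ) i)) atTop
      (𝓝 ({q : stdSimplex ℝ (Fin d) | ∀ i, (x i : ℝ) * (q : Fin d → ℝ) i ≤
        x j * (q : Fin d → ℝ) j}.indicator (fun q => (q : Fin d → ℝ) j) q)) := by
  have : Nonempty (Fin d) := ⟨j⟩
  simp only [iSup_update_mul]
  by_cases h : ∀ i, (x i : ℝ) * (q : Fin d → ℝ) i ≤ x j * (q : Fin d → ℝ) j
  · rw [indicator_of_mem (by exact h)]
    have hs : ⨆ i, (x i : ℝ) * (q : Fin d → ℝ) i = x j * (q : Fin d → ℝ) j :=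
      le_antisymm (ciSup_le h)
        (le_ciSup (f := fun i => (x i : ℝ) * (q : Fin d → ℝ) i) (Set.finite_range _).bddAbove j)
    refine tendsto_const_nhds.congr fun n => ?_
    have hq := stdSimplex_nonneg q j
    rw [hs, max_eq_right (mul_le_mul_of_nonneg_right (by simp; positivity) hq)]
    push_cast
    field_simp
    ring
  · rw [indicator_of_notMem (by exact h)]
    push Not at h
    obtain ⟨i, hi⟩ := h
    have hlt : x j * (q : Fin d → ℝ) j < ⨆ i, (x i : ℝ) * (q : Fin d → ℝ) i := hi.trans_le
      (le_ciSup (f := fun i => (x i : ℝ) * (q : Fin d → ℝ) i) (Set.finite_range _).bddAbove i)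
    have hl : Tendsto (fun n : ℕ => ((x j : ℝ) + 1 / ((n : ℝ) + 1)) * (q : Fin d → ℝ) j) atTop
        (𝓝 (x j * (q : Fin d → ℝ) j)) := by
      simpa using ((tendsto_one_div_add_atTop_nhds_zero_nat (𝕜 := ℝ)).const_add
        (x j : ℝ)).mul_const ((q : Fin d → ℝ) j)
    refine tendsto_const_nhds.congr' ?_
    filter_upwards [hl.eventually_lt_const hlt] with n hn
    push_cast
    rw [max_eq_left hn.le, sub_self, mul_zero]

theorem abs_slope_iSup_le (x : Fin d → ℝ≥0) (j : Fin d) (q : stdSimplex ℝ (Fin d)) (n : ℕ) :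
    |((n : ℝ) + 1) *
      ((⨆ i, (Function.update x j (x j + 1 / ((n : ℝ≥0) + 1)) i : ℝ) * (q : Fin d → ℝ) i) -
        ⨆ i, (x i : ℝ) * (q : Fin d → ℝ) i)| ≤ 1 := by
  rw [iSup_update_mul]
  have hq := stdSimplex_nonneg q j
  have hq1 := stdSimplex_le_one q j
  have hle : (x j : ℝ) * (q : Fin d → ℝ) j ≤ ⨆ i, (x i : ℝ) * (q : Fin d → ℝ) i :=
    le_ciSup (f := fun i => (x i : ℝ) * (q : Fin d → ℝ) i) (Set.finite_range _).bddAbove j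
  set s := ⨆ i, (x i : ℝ) * (q : Fin d → ℝ) i
  have hn : (0 : ℝ) < n + 1 := by positivity
  have h0 : 0 ≤ max s (((x j : ℝ) + ((1 / ((n : ℝ≥0) + 1) : ℝ≥0) : ℝ)) * (q : Fin d → ℝ) j) - s :=
    sub_nonneg.2 (le_max_left _ _)
  have h1 : max s (((x j : ℝ) + ((1 / ((n : ℝ≥0) + 1) : ℝ≥0) : ℝ)) * (q : Fin d → ℝ) j) - s
      ≤ 1 / ((n : ℝ) + 1) := by
    rw [sub_le_iff_le_add]
    refine max_le (le_add_of_nonneg_left (by positivity)) ?_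
    push_cast
    have : 1 / ((n : ℝ) + 1) * (q : Fin d → ℝ) j ≤ 1 / ((n : ℝ) + 1) :=
      mul_le_of_le_one_right (by positivity) hq1
    linarith [add_mul (x j : ℝ) (1 / ((n : ℝ) + 1)) ((q : Fin d → ℝ) j)]
  rw [abs_of_nonneg (mul_nonneg hn.le h0)]
  calc _ ≤ ((n : ℝ) + 1) * (1 / ((n : ℝ) + 1)) := mul_le_mul_of_nonneg_left h1 hn.le
    _ = 1 := mul_one_div_cancel hn.ne'

theorem continuous_iSup_mul_stdSimplex (x : Fin d → ℝ≥0) :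
    Continuous fun q : stdSimplex ℝ (Fin d) => ⨆ i, (x i : ℝ) * (q : Fin d → ℝ) i :=
  Real.continuous_iSup_of_finite fun i => continuous_const.mul (continuous_stdSimplex_apply i)

theorem integrable_iSup_mul_stdSimplex (H : Measure (stdSimplex ℝ (Fin d))) [IsFiniteMeasure H]
    (x : Fin d → ℝ≥0) : Integrable (fun q : stdSimplex ℝ (Fin d) =>
      ⨆ i, (x i : ℝ) * (q : Fin d → ℝ) i) H :=
  (continuous_iSup_mul_stdSimplex x).integrable_of_hasCompactSupport
    (HasCompactSupport.of_compactSpace _)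

theorem measurableSet_argmax (x : Fin d → ℝ≥0) (j : Fin d) :
    MeasurableSet {q : stdSimplex ℝ (Fin d) | ∀ i, (x i : ℝ) * (q : Fin d → ℝ) i ≤
        x j * (q : Fin d → ℝ) j} := by
  have : {q : stdSimplex ℝ (Fin d) | ∀ i, (x i : ℝ) * (q : Fin d → ℝ) i ≤
      x j * (q : Fin d → ℝ) j} = ⋂ i, {q : stdSimplex ℝ (Fin d) |
        (x i : ℝ) * (q : Fin d → ℝ) i ≤ x j * (q : Fin d → ℝ) j} := by
    ext; simp
  rw [this]
  refine MeasurableSet.iInter fun i => (isClosed_le ?_ ?_).measurableSet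
  · exact continuous_const.mul (continuous_stdSimplex_apply i)
  · exact continuous_const.mul (continuous_stdSimplex_apply j)

/-- Differentiating `∫ maxᵢ xᵢ qᵢ dH` in the direction of the coordinate `j` determines the measure
`qⱼ dH` on the sets where the maximum is attained at `j`. -/
theorem withDensity_argmax_eq {H H' : Measure (stdSimplex ℝ (Fin d))} [IsFiniteMeasure H]
    [IsFiniteMeasure H'] (h : ∀ x : Fin d → ℝ≥0,
      ∫ q, ⨆ i, (x i : ℝ) * (q : Fin d → ℝ) i ∂H = ∫ q, ⨆ i, (x i : ℝ) * (q : Fin d → ℝ) i ∂H')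
    (x : Fin d → ℝ≥0) (j : Fin d) :
    H.withDensity (fun q => ENNReal.ofReal ((q : Fin d → ℝ) j))
      {q | ∀ i, (x i : ℝ) * (q : Fin d → ℝ) i ≤ x j * (q : Fin d → ℝ) j} =
    H'.withDensity (fun q => ENNReal.ofReal ((q : Fin d → ℝ) j))
      {q | ∀ i, (x i : ℝ) * (q : Fin d → ℝ) i ≤ x j * (q : Fin d → ℝ) j} := by
  set A := {q : stdSimplex ℝ (Fin d) | ∀ i, (x i : ℝ) * (q : Fin d → ℝ) i ≤
    x j * (q : Fin d → ℝ) j}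
  have hA : MeasurableSet A := measurableSet_argmax x j
  have hint : ∀ (ρ : Measure (stdSimplex ℝ (Fin d))) [IsFiniteMeasure ρ],
      Integrable (fun q : stdSimplex ℝ (Fin d) => (q : Fin d → ℝ) j) ρ := fun ρ _ =>
    (continuous_stdSimplex_apply j).integrable_of_hasCompactSupport
      (HasCompactSupport.of_compactSpace _)
  have hlim : ∀ (ρ : Measure (stdSimplex ℝ (Fin d))) [IsFiniteMeasure ρ],
      Tendsto (fun n : ℕ => ((n : ℝ) + 1) *
        ((∫ q, ⨆ i, (Function.update x j (x j + 1 / ((n : ℝ≥0) + 1)) i : ℝ) *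
          (q : Fin d → ℝ) i ∂ρ) - ∫ q, ⨆ i, (x i : ℝ) * (q : Fin d → ℝ) i ∂ρ)) atTop
        (𝓝 (∫ q in A, (q : Fin d → ℝ) j ∂ρ)) := by
    intro ρ _
    rw [← integral_indicator hA]
    refine (tendsto_integral_of_dominated_convergence (fun _ => (1 : ℝ)) (fun n => ?_)
      (integrable_const _) (fun n => ae_of_all _ fun q => abs_slope_iSup_le x j q n)
      (ae_of_all _ fun q => tendsto_slope_iSup x j q)).congr fun n => ?_
    · exact (((continuous_iSup_mul_stdSimplex _).sub
        (continuous_iSup_mul_stdSimplex _)).const_mul _).aestronglyMeasurable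
    · rw [integral_const_mul, integral_sub (integrable_iSup_mul_stdSimplex ρ _)
        (integrable_iSup_mul_stdSimplex ρ _)]
  have heq : ∫ q in A, (q : Fin d → ℝ) j ∂H = ∫ q in A, (q : Fin d → ℝ) j ∂H' :=
    tendsto_nhds_unique (hlim H) ((hlim H').congr fun n => by rw [h, h])
  rw [withDensity_apply _ hA, withDensity_apply _ hA,
    ← ofReal_integral_eq_lintegral_ofReal (hint H).integrableOn
      (ae_of_all _ fun q => stdSimplex_nonneg q j),
    ← ofReal_integral_eq_lintegral_ofReal (hint H').integrableOn
      (ae_of_all _ fun q => stdSimplex_nonneg q j), heq]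

/-- On the part of the simplex where `qⱼ > 0` a point is determined by its ratios `qᵢ / qⱼ`, and
the joint distribution function of the ratios is given by the sets on which the maximum of
`xᵢ qᵢ` is attained at `j`. -/
theorem withDensity_apply_eq {H H' : Measure (stdSimplex ℝ (Fin d))} [IsFiniteMeasure H]
    [IsFiniteMeasure H'] (h : ∀ x : Fin d → ℝ≥0,
      ∫ q, ⨆ i, (x i : ℝ) * (q : Fin d → ℝ) i ∂H = ∫ q, ⨆ i, (x i : ℝ) * (q : Fin d → ℝ) i ∂H')
    (j : Fin d) :
    H.withDensity (fun q => ENNReal.ofReal ((q : Fin d → ℝ) j)) =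
      H'.withDensity (fun q => ENNReal.ofReal ((q : Fin d → ℝ) j)) := by
  have hcm : ∀ i : Fin d, Measurable fun q : stdSimplex ℝ (Fin d) => (q : Fin d → ℝ) i := fun i =>
    (continuous_stdSimplex_apply i).measurable
  have hfin : ∀ (ρ : Measure (stdSimplex ℝ (Fin d))) [IsFiniteMeasure ρ],
      IsFiniteMeasure (ρ.withDensity fun q => ENNReal.ofReal ((q : Fin d → ℝ) j)) := fun ρ _ =>
    isFiniteMeasure_withDensity_ofReal
      ((continuous_stdSimplex_apply j).integrable_of_hasCompactSupport
        (HasCompactSupport.of_compactSpace _)).2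
  have := hfin H
  have := hfin H'
  have hpos : ∀ ρ : Measure (stdSimplex ℝ (Fin d)),
      ∀ᵐ q : stdSimplex ℝ (Fin d) ∂ρ.withDensity fun q => ENNReal.ofReal ((q : Fin d → ℝ) j),
        0 < (q : Fin d → ℝ) j := by
    intro ρ
    rw [ae_withDensity_iff (hcm j).ennreal_ofReal]
    exact ae_of_all _ fun q hq => ENNReal.ofReal_pos.1 (pos_iff_ne_zero.2 hq)
  let r : stdSimplex ℝ (Fin d) → Fin d → ℝ := fun q i => (q : Fin d → ℝ) i / (q : Fin d → ℝ) j
  have hr : Measurable r := measurable_pi_lambda _ fun i => (hcm i).div (hcm j)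
  have hr0 : ∀ q i, 0 ≤ r q i := fun q i =>
    div_nonneg (stdSimplex_nonneg q i) (stdSimplex_nonneg q j)
  set G := H.withDensity fun q => ENNReal.ofReal ((q : Fin d → ℝ) j)
  set G' := H'.withDensity fun q => ENNReal.ofReal ((q : Fin d → ℝ) j)
  have hmap : G.map r = G'.map r := by
    have hae : ∀ ρ : Measure (stdSimplex ℝ (Fin d)), ∀ᵐ y ∂ρ.map r, ∀ i, 0 ≤ y i := fun ρ => by
      rw [ae_map_iff hr.aemeasurable]
      · exact ae_of_all _ hr0
      · simp only [ofPred_forall]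
        exact MeasurableSet.iInter fun i => measurableSet_le measurable_const (measurable_pi_apply i)
    refine Measure.ext_of_Iic_pos (hae G) (hae G') fun t ht => ?_
    rw [Measure.map_apply hr measurableSet_Iic, Measure.map_apply hr measurableSet_Iic]
    by_cases htj : 1 ≤ t j
    · let x : Fin d → ℝ≥0 := Function.update (fun i => (t i).toNNReal⁻¹) j 1
      have hset : ∀ ρ : Measure (stdSimplex ℝ (Fin d)), (∀ᵐ q : stdSimplex ℝ (Fin d) ∂ρ, 0 < (q : Fin d → ℝ) j) →
          ρ (r ⁻¹' Iic t) = ρ {q | ∀ i, (x i : ℝ) * (q : Fin d → ℝ) i ≤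
            x j * (q : Fin d → ℝ) j} := by
        intro ρ hρ
        refine measure_congr ?_
        filter_upwards [hρ] with q hq
        refine propext (forall_congr' fun i => ?_)
        change (q : Fin d → ℝ) i / (q : Fin d → ℝ) j ≤ t i ↔ _
        rcases eq_or_ne i j with rfl | hij
        · rw [div_self hq.ne']
          exact iff_of_true htj le_rfl
        · have hxi : (x i : ℝ) = (t i)⁻¹ := by simp [x, hij, (ht i).le]
          have hxj : (x j : ℝ) = 1 := by simp [x]
          rw [hxi, hxj, one_mul, div_le_iff₀ hq, inv_mul_le_iff₀ (ht i)]
      rw [hset G (hpos H), hset G' (hpos H')]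
      exact withDensity_argmax_eq h x j
    · have hz : ∀ ρ : Measure (stdSimplex ℝ (Fin d)), (∀ᵐ q : stdSimplex ℝ (Fin d) ∂ρ, 0 < (q : Fin d → ℝ) j) →
          ρ (r ⁻¹' Iic t) = 0 := by
        intro ρ hρ
        refine measure_mono_null (fun q hq => ?_) (ae_iff.1 hρ)
        intro hqj
        have h1 : (q : Fin d → ℝ) j / (q : Fin d → ℝ) j ≤ t j := hq j
        rw [div_self hqj.ne'] at h1
        exact htj h1
      rw [hz G (hpos H), hz G' (hpos H')]
  -- the point is recovered from its ratios by normalization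
  let ψ : (Fin d → ℝ) → Fin d → ℝ := fun y i => y i / ∑ k, y k
  have hψ : Measurable ψ := measurable_pi_lambda _ fun i =>
    (measurable_pi_apply i).div (Finset.measurable_sum _ fun k _ => measurable_pi_apply k)
  have hcoe : ∀ ρ : Measure (stdSimplex ℝ (Fin d)), (∀ᵐ q : stdSimplex ℝ (Fin d) ∂ρ, 0 < (q : Fin d → ℝ) j) →
      (ρ.map r).map ψ = ρ.map ((↑) : stdSimplex ℝ (Fin d) → Fin d → ℝ) := by
    intro ρ hρ
    rw [Measure.map_map hψ hr]
    refine Measure.map_congr ?_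
    filter_upwards [hρ] with q hq
    funext i
    simp only [Function.comp_apply, ψ, r, ← Finset.sum_div]
    have hs : ∑ k, (q : Fin d → ℝ) k = 1 := q.2.2
    rw [hs]
    field_simp
  have hemb : MeasurableEmbedding ((↑) : stdSimplex ℝ (Fin d) → Fin d → ℝ) :=
    MeasurableEmbedding.subtype_coe (isCompact_stdSimplex ℝ (Fin d)).isClosed.measurableSet
  rw [← hemb.comap_map G, ← hemb.comap_map G', ← hcoe G (hpos H), ← hcoe G' (hpos H'), hmap]

/-- A finite measure `H` on the simplex is determined by the function `x ↦ ∫ maxᵢ xᵢ qᵢ dH`, since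
the measures `qⱼ dH` are and the coordinates sum to one. -/
theorem measure_ext_of_integral_iSup {H H' : Measure (stdSimplex ℝ (Fin d))} [IsFiniteMeasure H]
    [IsFiniteMeasure H'] (h : ∀ x : Fin d → ℝ≥0,
      ∫ q, ⨆ i, (x i : ℝ) * (q : Fin d → ℝ) i ∂H = ∫ q, ⨆ i, (x i : ℝ) * (q : Fin d → ℝ) i ∂H') :
    H = H' := by
  have hsum : ∀ ρ : Measure (stdSimplex ℝ (Fin d)), ∀ A, MeasurableSet A →
      ρ A = ∑ j, ρ.withDensity (fun q => ENNReal.ofReal ((q : Fin d → ℝ) j)) A := by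
    intro ρ A hA
    simp_rw [withDensity_apply _ hA]
    rw [← lintegral_finsetSum _ fun j _ =>
      (continuous_stdSimplex_apply j).measurable.ennreal_ofReal]
    have h1 : ∀ q : stdSimplex ℝ (Fin d), ∑ j, ENNReal.ofReal ((q : Fin d → ℝ) j) = 1 := by
      intro q
      have hs : ∑ k, (q : Fin d → ℝ) k = 1 := q.2.2
      rw [← ENNReal.ofReal_sum_of_nonneg fun j _ => stdSimplex_nonneg q j, hs, ENNReal.ofReal_one]
    simp [h1]
  refine Measure.ext fun A hA => ?_
  rw [hsum H A hA, hsum H' A hA]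
  simp_rw [withDensity_apply_eq h]

end Uniqueness

/-! ### Uniqueness of the mixing measure on the classes -/

section Symmetrize

variable {d : ℕ}

/-- The point of the simplex with permuted coordinates. -/
def permuteSimplex (σ : Equiv.Perm (Fin d)) (q : stdSimplex ℝ (Fin d)) : stdSimplex ℝ (Fin d) :=
  ⟨fun i => (q : Fin d → ℝ) (σ i), fun i => q.2.1 (σ i), by
    rw [Equiv.sum_comp σ (q : Fin d → ℝ)]; exact q.2.2⟩

theorem continuous_permuteSimplex (σ : Equiv.Perm (Fin d)) :
    Continuous (permuteSimplex σ : stdSimplex ℝ (Fin d) → stdSimplex ℝ (Fin d)) :=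
  Continuous.subtype_mk (continuous_pi fun i => continuous_stdSimplex_apply (σ i)) _

theorem mk_permuteSimplex (σ : Equiv.Perm (Fin d)) (q : stdSimplex ℝ (Fin d)) :
    PermClass.mk (permuteSimplex σ q) = PermClass.mk q :=
  Quotient.sound (s := permSetoid d) ⟨σ, fun _ => rfl⟩

/-- The sum over all permutations `σ` of the point masses at the permuted points of a class. -/
noncomputable def PermClass.orbitMeasure (c : PermClass d) : Measure (stdSimplex ℝ (Fin d)) :=
  Quotient.lift (fun q => ∑ σ : Equiv.Perm (Fin d), Measure.dirac (permuteSimplex σ q))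
    (fun q r hqr => by
      obtain ⟨τ, h⟩ : ∃ τ : Equiv.Perm (Fin d), ∀ i, (q : Fin d → ℝ) i = (r : Fin d → ℝ) (τ i) :=
        hqr
      rw [← Equiv.sum_comp (Equiv.mulLeft τ) fun σ => Measure.dirac (permuteSimplex σ r)]
      refine Finset.sum_congr rfl fun σ _ => ?_
      congr 1
      exact Subtype.ext (funext fun i => h (σ i))) c

theorem PermClass.orbitMeasure_mk (q : stdSimplex ℝ (Fin d)) :
    (PermClass.mk q).orbitMeasure
      = ∑ σ : Equiv.Perm (Fin d), Measure.dirac (permuteSimplex σ q) := rfl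

theorem PermClass.measurable_orbitMeasure :
    Measurable (PermClass.orbitMeasure : PermClass d → Measure (stdSimplex ℝ (Fin d))) := by
  have : PolishSpace (stdSimplex ℝ (Fin d)) :=
    (isCompact_stdSimplex ℝ (Fin d)).isClosed.polishSpace
  rw [← PermClass.continuous_mk.measurable.measurable_comp_iff_of_surjective
    PermClass.mk_surjective]
  refine Measure.measurable_of_measurable_coe _ fun A hA => ?_
  simp only [Function.comp_apply, PermClass.orbitMeasure_mk, Measure.finsetSum_apply,
    Measure.dirac_apply' _ hA]
  exact Finset.measurable_sum _ fun σ _ => (measurable_one.indicator hA).comp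
    (continuous_permuteSimplex σ).measurable

/-- The symmetric measure on the simplex that lifts a measure on the set of classes. -/
noncomputable def symmetricLift (ν : Measure (PermClass d)) : Measure (stdSimplex ℝ (Fin d)) :=
  ν.bind PermClass.orbitMeasure

theorem map_mk_symmetricLift (ν : Measure (PermClass d)) {B : Set (PermClass d)}
    (hB : MeasurableSet B) : symmetricLift ν (PermClass.mk ⁻¹' B) = d.factorial * ν B := by
  have hB' := PermClass.continuous_mk.measurable hB
  rw [symmetricLift, Measure.bind_apply hB' PermClass.measurable_orbitMeasure.aemeasurable]
  have h1 : ∀ c : PermClass d, c.orbitMeasure (PermClass.mk ⁻¹' B)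
      = B.indicator (fun _ => (d.factorial : ENNReal)) c := by
    intro c
    obtain ⟨q, rfl⟩ := PermClass.mk_surjective c
    rw [PermClass.orbitMeasure_mk, Measure.finsetSum_apply]
    by_cases hq : PermClass.mk q ∈ B
    · simp [Measure.dirac_apply' _ hB', mk_permuteSimplex, hq, Finset.card_univ,
        Fintype.card_perm, indicator]
    · simp [Measure.dirac_apply' _ hB', mk_permuteSimplex, hq, indicator]
  simp_rw [h1]
  rw [lintegral_indicator_const hB]

theorem isFiniteMeasure_symmetricLift (ν : Measure (PermClass d)) [IsFiniteMeasure ν] :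
    IsFiniteMeasure (symmetricLift ν) := by
  refine ⟨?_⟩
  rw [← preimage_univ (f := (PermClass.mk : stdSimplex ℝ (Fin d) → PermClass d)),
    map_mk_symmetricLift ν MeasurableSet.univ]
  exact ENNReal.mul_lt_top (ENNReal.natCast_lt_top _) (measure_lt_top _ _)

theorem integral_iSup_symmetricLift (ν : Measure (PermClass d)) [IsFiniteMeasure ν]
    (x : Fin d → ℝ≥0) :
    ∫ q, ⨆ i, (x i : ℝ) * (q : Fin d → ℝ) i ∂symmetricLift ν
      = (d - 1).factorial * ∫ c, c.tail x ∂ν := by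
  have hpos : ∀ q : stdSimplex ℝ (Fin d), 0 ≤ ⨆ i, (x i : ℝ) * (q : Fin d → ℝ) i := fun q =>
    Real.iSup_nonneg fun i => mul_nonneg (x i).2 (stdSimplex_nonneg q i)
  have hf : ((d - 1).factorial : ℝ) ≠ 0 := Nat.cast_ne_zero.2 (Nat.factorial_ne_zero _)
  have hmul : ∀ q : stdSimplex ℝ (Fin d), (d - 1).factorial * permTail q x =
      ∑ σ : Equiv.Perm (Fin d), ⨆ i, (x i : ℝ) * (permuteSimplex σ q : Fin d → ℝ) i := fun q => by
    unfold permTail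
    rw [← mul_assoc, mul_one_div_cancel hf, one_mul]
    rfl
  have hpos' : ∀ c : PermClass d, 0 ≤ (d - 1).factorial * c.tail x := by
    intro c
    obtain ⟨q, rfl⟩ := PermClass.mk_surjective c
    rw [PermClass.tail_mk, hmul]
    exact Finset.sum_nonneg fun σ _ => hpos _
  have hm := (continuous_iSup_mul_stdSimplex x).measurable
  rw [← integral_const_mul, integral_eq_lintegral_of_nonneg_ae (ae_of_all _ hpos)
    hm.aestronglyMeasurable, integral_eq_lintegral_of_nonneg_ae (ae_of_all _ hpos')
    ((PermClass.continuous_tail_apply x).const_mul _).aestronglyMeasurable, symmetricLift,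
    Measure.lintegral_bind PermClass.measurable_orbitMeasure.aemeasurable
    hm.ennreal_ofReal.aemeasurable]
  congr 1
  refine lintegral_congr fun c => ?_
  obtain ⟨q, rfl⟩ := PermClass.mk_surjective c
  rw [PermClass.orbitMeasure_mk, lintegral_finsetSum_measure, PermClass.tail_mk, hmul,
    ENNReal.ofReal_sum_of_nonneg fun σ _ => hpos _]
  exact Finset.sum_congr rfl fun σ _ => lintegral_dirac' _ hm.ennreal_ofReal

/-- The mixing measure of a mixture of the functions `permTail q` is unique. -/
theorem measure_ext_of_integral_tail {ν ν' : Measure (PermClass d)} [IsFiniteMeasure ν]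
    [IsFiniteMeasure ν'] (h : ∀ x, ∫ c, c.tail x ∂ν = ∫ c, c.tail x ∂ν') : ν = ν' := by
  have := isFiniteMeasure_symmetricLift ν
  have := isFiniteMeasure_symmetricLift ν'
  have hlift : symmetricLift ν = symmetricLift ν' := measure_ext_of_integral_iSup fun x => by
    rw [integral_iSup_symmetricLift, integral_iSup_symmetricLift, h]
  refine Measure.ext fun B hB => ?_
  have h1 := map_mk_symmetricLift ν hB
  rw [hlift, map_mk_symmetricLift ν' hB] at h1
  exact ((ENNReal.mul_right_inj (Nat.cast_ne_zero.2 (Nat.factorial_ne_zero d))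
    (ENNReal.natCast_ne_top _)).1 h1).symm

end Symmetrize

/-! ### Extreme points and the simplex property -/

section Simplex

variable {d : ℕ}

theorem PermClass.tail_injective : Function.Injective (PermClass.tail (d := d)) := by
  intro c e h
  have h1 : Measure.dirac c = Measure.dirac e := measure_ext_of_integral_tail fun x => by
    rw [integral_dirac, integral_dirac, h]
  exact dirac_eq_dirac_iff.1 h1

/-- A mixture of two representing measures represents the mixture of the two functions. -/
theorem integral_tail_mix {ν ν' : Measure (PermClass d)} [IsProbabilityMeasure ν]
    [IsProbabilityMeasure ν'] {a b : ℝ} (ha : 0 ≤ a) (hb : 0 ≤ b) (hab : a + b = 1) :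
    IsProbabilityMeasure (ENNReal.ofReal a • ν + ENNReal.ofReal b • ν') ∧
      ∀ x, ∫ c, c.tail x ∂(ENNReal.ofReal a • ν + ENNReal.ofReal b • ν') =
        a * ∫ c, c.tail x ∂ν + b * ∫ c, c.tail x ∂ν' := by
  refine ⟨⟨?_⟩, fun x => ?_⟩
  · simp [← ENNReal.ofReal_add ha hb, hab]
  · rw [integral_add_measure
      ((PermClass.integrable_tail_apply ν x).smul_measure ENNReal.ofReal_ne_top)
      ((PermClass.integrable_tail_apply ν' x).smul_measure ENNReal.ofReal_ne_top),
      integral_smul_measure, integral_smul_measure, ENNReal.toReal_ofReal ha,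
      ENNReal.toReal_ofReal hb, smul_eq_mul, smul_eq_mul]

theorem permTail_mem_symmetricTailFunctions [NeZero d] (q : stdSimplex ℝ (Fin d)) :
    permTail q ∈ symmetricTailFunctions d :=
  convexHull_range_tail_subset d (subset_convexHull ℝ _ ⟨PermClass.mk q, rfl⟩)

theorem tail_mem_symmetricTailFunctions [NeZero d] (c : PermClass d) :
    c.tail ∈ symmetricTailFunctions d :=
  convexHull_range_tail_subset d (subset_convexHull ℝ _ ⟨c, rfl⟩)

theorem convex_symmetricTailFunctions (d : ℕ) [NeZero d] : Convex ℝ (symmetricTailFunctions d) := by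
  intro ℓ hℓ ℓ' hℓ' a b ha hb hab
  obtain ⟨ν, hν, hνx⟩ := exists_measure_integral_tail_eq hℓ
  obtain ⟨ν', hν', hνx'⟩ := exists_measure_integral_tail_eq hℓ'
  obtain ⟨hp, hx⟩ := integral_tail_mix (ν := ν) (ν' := ν') ha hb hab
  convert integral_tail_mem (ENNReal.ofReal a • ν + ENNReal.ofReal b • ν') using 1
  funext x
  simp [hx, hνx, hνx']

theorem isCompact_symmetricTailFunctions (d : ℕ) [NeZero d] :
    IsCompact (symmetricTailFunctions d) := by
  convert isCompact_range_integral_tail d using 1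
  refine Subset.antisymm (fun ℓ hℓ => ?_) ?_
  · obtain ⟨ν, hν, hνx⟩ := exists_measure_integral_tail_eq hℓ
    exact ⟨⟨ν, hν⟩, funext fun x => (hνx x).symm⟩
  · rintro _ ⟨P, rfl⟩
    exact integral_tail_mem (P : Measure (PermClass d))

/-- The elements of the compact set are continuous functions, hence determined by their values on a
countable dense set of arguments. -/
theorem metrizableSpace_symmetricTailFunctions (d : ℕ) [NeZero d] :
    TopologicalSpace.MetrizableSpace (symmetricTailFunctions d) := by
  have : CompactSpace (symmetricTailFunctions d) :=
    isCompact_iff_compactSpace.1 (isCompact_symmetricTailFunctions d)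
  obtain ⟨s, hs, hdense⟩ := TopologicalSpace.exists_countable_dense (Fin d → ℝ≥0)
  have : Countable s := hs.to_subtype
  let ρ : symmetricTailFunctions d → s → ℝ := fun ℓ x => (ℓ : (Fin d → ℝ≥0) → ℝ) x
  have hρ : Continuous ρ :=
    continuous_pi fun x => (continuous_apply (x : Fin d → ℝ≥0)).comp continuous_subtype_val
  have hinj : Function.Injective ρ := fun ℓ ℓ' h => Subtype.ext <|
    Continuous.ext_on hdense ℓ.2.1.continuous ℓ'.2.1.continuous fun x hx => congrFun h ⟨x, hx⟩
  exact (hρ.isClosedEmbedding hinj).isEmbedding.metrizableSpace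

theorem tail_mem_extremePoints [NeZero d] (c : PermClass d) :
    c.tail ∈ (symmetricTailFunctions d).extremePoints ℝ := by
  refine mem_extremePoints_iff_left.2 ⟨tail_mem_symmetricTailFunctions c, ?_⟩
  rintro ℓ hℓ ℓ' hℓ' ⟨a, b, ha, hb, hab, h⟩
  obtain ⟨ν, hν, hνx⟩ := exists_measure_integral_tail_eq hℓ
  obtain ⟨ν', hν', hνx'⟩ := exists_measure_integral_tail_eq hℓ'
  obtain ⟨hp, hx⟩ := integral_tail_mix (ν := ν) (ν' := ν') ha.le hb.le hab
  have h1 : ENNReal.ofReal a • ν + ENNReal.ofReal b • ν' = Measure.dirac c :=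
    measure_ext_of_integral_tail fun x => by
      rw [hx, integral_dirac, ← h, ← hνx, ← hνx']
      simp
  have h2 : ν {c}ᶜ = 0 := by
    have h3 := congrArg (fun ρ : Measure (PermClass d) => ρ {c}ᶜ) h1
    rw [Measure.add_apply, Measure.smul_apply, Measure.smul_apply, smul_eq_mul, smul_eq_mul,
      Measure.dirac_apply' _ (measurableSet_singleton c).compl,
      indicator_of_notMem (by simp)] at h3
    exact (mul_eq_zero.1 (add_eq_zero.1 h3).1).resolve_left (ENNReal.ofReal_pos.2 ha).ne'
  have h4 : ∀ᵐ e ∂ν, e = c := by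
    rw [ae_iff]
    exact h2
  funext x
  rw [hνx, integral_congr_ae (g := fun _ => c.tail x) (h4.mono fun e he => by simp [he])]
  simp

/-- The representing measure of an extreme point takes only the values zero and one, since
conditioning on a set of intermediate measure would split it. Hence it is a point mass. -/
theorem exists_tail_eq_of_mem_extremePoints [NeZero d] {ℓ : (Fin d → ℝ≥0) → ℝ}
    (hℓ : ℓ ∈ (symmetricTailFunctions d).extremePoints ℝ) : ∃ c : PermClass d, c.tail = ℓ := by
  rw [mem_extremePoints_iff_left] at hℓ
  obtain ⟨ν, hν, hνx⟩ := exists_measure_integral_tail_eq hℓ.1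
  have h01 : ∀ A, MeasurableSet A → ν A = 0 ∨ ν A = 1 := by
    intro A hA
    by_contra! hne
    obtain ⟨h0, h1⟩ := hne
    have h0' : ν Aᶜ ≠ 0 := fun h => h1 ((prob_compl_eq_zero_iff hA).1 h)
    have := ProbabilityTheory.cond_isProbabilityMeasure h0
    have := ProbabilityTheory.cond_isProbabilityMeasure h0'
    have hab : ν.real A + ν.real Aᶜ = 1 := probReal_add_probReal_compl hA
    have hpos : ∀ B, ν B ≠ 0 → 0 < ν.real B := fun B hB =>
      ENNReal.toReal_pos hB (measure_ne_top _ _)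
    obtain ⟨-, hx⟩ := integral_tail_mix (ν := ProbabilityTheory.cond ν A)
      (ν' := ProbabilityTheory.cond ν Aᶜ) measureReal_nonneg measureReal_nonneg hab
    have hmix : ENNReal.ofReal (ν.real A) • ProbabilityTheory.cond ν A +
        ENNReal.ofReal (ν.real Aᶜ) • ProbabilityTheory.cond ν Aᶜ = ν := by
      rw [ofReal_measureReal, ofReal_measureReal, ProbabilityTheory.cond, ProbabilityTheory.cond,
        smul_smul, smul_smul, ENNReal.mul_inv_cancel h0 (measure_ne_top _ _),
        ENNReal.mul_inv_cancel h0' (measure_ne_top _ _), one_smul, one_smul,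
        Measure.restrict_add_restrict_compl hA]
    rw [hmix] at hx
    have h2 := hℓ.2 _ (integral_tail_mem (ProbabilityTheory.cond ν A)) _
      (integral_tail_mem (ProbabilityTheory.cond ν Aᶜ))
      ⟨ν.real A, ν.real Aᶜ, hpos _ h0, hpos _ h0', hab, by
        funext x; simp only [Pi.add_apply, Pi.smul_apply, smul_eq_mul]; rw [hνx, hx]⟩
    have h3 : ProbabilityTheory.cond ν A = ν := measure_ext_of_integral_tail fun x => by
      rw [← hνx]; exact congrFun h2 x
    have h4 : ProbabilityTheory.cond ν A A = 1 := ProbabilityTheory.cond_apply_self h0 (measure_ne_top _ _)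
    exact h1 (h3 ▸ h4)
  have : IsZeroOneMeasure ν := ⟨h01⟩
  obtain ⟨c, hc⟩ := IsZeroOneMeasure.exists_eq_dirac (μ := ν)
  refine ⟨c, funext fun x => ?_⟩
  rw [hνx, hc, integral_dirac]

theorem extremePoints_symmetricTailFunctions (d : ℕ) [NeZero d] :
    (symmetricTailFunctions d).extremePoints ℝ = Set.range (PermClass.tail (d := d)) :=
  Subset.antisymm (fun _ hℓ => exists_tail_eq_of_mem_extremePoints hℓ)
    (Set.range_subset_iff.2 tail_mem_extremePoints)

/-- A continuous linear functional on a product of lines depends on finitely many coordinates. -/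
theorem exists_finset_sum_eq_of_continuousLinearMap {X : Type*} (φ : (X → ℝ) →L[ℝ] ℝ) :
    ∃ (F : Finset X) (a : X → ℝ), ∀ f, φ f = ∑ x ∈ F, f x * a x := by
  classical
  have hU : {f | |φ f| < 1} ∈ 𝓝 (0 : X → ℝ) := by
    refine (isOpen_lt (continuous_abs.comp φ.continuous) continuous_const).mem_nhds ?_
    simp
  rw [nhds_pi, Filter.mem_pi'] at hU
  obtain ⟨F, V, hV, hVU⟩ := hU
  have hzero : ∀ f : X → ℝ, (∀ x ∈ F, f x = 0) → φ f = 0 := by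
    intro f hf
    by_contra hne
    have h1 : (φ f)⁻¹ • f ∈ {f | |φ f| < 1} := hVU fun x hx => by
      rw [Pi.smul_apply, hf x hx, smul_zero]
      exact mem_of_mem_nhds (hV x)
    rw [mem_ofPred_eq, map_smul, smul_eq_mul, inv_mul_cancel₀ hne] at h1
    simp at h1
  refine ⟨F, fun x => φ (Pi.single x 1), fun f => ?_⟩
  have h1 := hzero (f - ∑ x ∈ F, f x • Pi.single x 1) fun y hy => by
    rw [Pi.sub_apply, Finset.sum_apply, Finset.sum_eq_single y]
    · simp
    · intro x _ hxy
      simp [Pi.single_eq_of_ne hxy.symm]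
    · exact fun h => absurd hy h
  rw [map_sub, sub_eq_zero, map_sum] at h1
  simpa using h1

theorem isMetrizableSimplex_symmetricTailFunctions (d : ℕ) [NeZero d] :
    IsMetrizableSimplex (symmetricTailFunctions d) := by
  refine ⟨convex_symmetricTailFunctions d, isCompact_symmetricTailFunctions d,
    metrizableSpace_symmetricTailFunctions d, ?_⟩
  let _ : MeasurableSpace ((symmetricTailFunctions d).extremePoints ℝ) := borel _
  have : BorelSpace ((symmetricTailFunctions d).extremePoints ℝ) := ⟨rfl⟩
  intro ℓ hℓ
  let T : PermClass d ≃ (symmetricTailFunctions d).extremePoints ℝ :=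
    Equiv.ofBijective (fun c => ⟨c.tail, tail_mem_extremePoints c⟩)
      ⟨fun c e h => PermClass.tail_injective (congrArg Subtype.val h), fun y => by
        obtain ⟨c, hc⟩ := exists_tail_eq_of_mem_extremePoints y.2
        exact ⟨c, Subtype.ext hc⟩⟩
  have hT : Continuous T := PermClass.continuous_tail.subtype_mk _
  let e : PermClass d ≃ₜ (symmetricTailFunctions d).extremePoints ℝ := hT.homeoOfEquivCompactToT2
  have he : ∀ c, ((e c : (symmetricTailFunctions d).extremePoints ℝ) : (Fin d → ℝ≥0) → ℝ)
      = c.tail := fun _ => rfl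
  obtain ⟨ν, hν, hνx⟩ := exists_measure_integral_tail_eq hℓ
  refine ⟨ν.map e, ⟨Measure.isProbabilityMeasure_map e.continuous.measurable.aemeasurable,
    fun φ => ?_⟩, ?_⟩
  · obtain ⟨F, a, hφ⟩ := exists_finset_sum_eq_of_continuousLinearMap φ
    have hm : Continuous fun y : (symmetricTailFunctions d).extremePoints ℝ => φ y :=
      φ.continuous.comp continuous_subtype_val
    rw [integral_map e.continuous.measurable.aemeasurable hm.measurable.aestronglyMeasurable]
    simp only [he, hφ]
    rw [integral_finsetSum _ fun x _ => (PermClass.integrable_tail_apply ν x).mul_const _]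
    refine Finset.sum_congr rfl fun x _ => ?_
    rw [integral_mul_const, hνx]
  · rintro μ ⟨hμ, hμφ⟩
    have : IsProbabilityMeasure (μ.map e.symm) :=
      Measure.isProbabilityMeasure_map e.symm.continuous.measurable.aemeasurable
    have h1 : μ.map e.symm = ν := measure_ext_of_integral_tail fun x => by
      rw [← hνx, integral_map e.symm.continuous.measurable.aemeasurable
        (PermClass.continuous_tail_apply x).aestronglyMeasurable]
      have h2 := hμφ (ContinuousLinearMap.proj x)
      simp only [ContinuousLinearMap.proj_apply] at h2
      rw [h2]
      refine integral_congr_ae (ae_of_all _ fun y => ?_)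
      simp only
      rw [← he, e.apply_symm_apply]
    rw [← h1, Measure.map_map e.continuous.measurable e.symm.continuous.measurable]
    simp

end Simplex

theorem lemma2 (d : ℕ) (hd : 1 ≤ d) :
    (∀ q : stdSimplex ℝ (Fin d), permTail q ∈ symmetricTailFunctions d) ∧
    IsMetrizableSimplex (symmetricTailFunctions d) ∧
    ∃ L : PermClass d → (Fin d → ℝ≥0) → ℝ,
      (∀ q : stdSimplex ℝ (Fin d), L (PermClass.mk q) = permTail q) ∧
      (symmetricTailFunctions d).extremePoints ℝ = Set.range L ∧
      (∀ ℓ ∈ symmetricTailFunctions d, ∃! ν : Measure (PermClass d), IsProbabilityMeasure ν ∧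
        ∀ x, ℓ x = ∫ c, L c x ∂ν) ∧
      (∀ ν : Measure (PermClass d), IsProbabilityMeasure ν →
        (fun x => ∫ c, L c x ∂ν) ∈ symmetricTailFunctions d) := by
  have : NeZero d := ⟨by omega⟩
  refine ⟨permTail_mem_symmetricTailFunctions, isMetrizableSimplex_symmetricTailFunctions d,
    PermClass.tail, fun _ => rfl, extremePoints_symmetricTailFunctions d, fun ℓ hℓ => ?_,
    fun ν _ => integral_tail_mem ν⟩
  obtain ⟨ν, hν, hνx⟩ := exists_measure_integral_tail_eq hℓ
  refine ⟨ν, ⟨hν, hνx⟩, ?_⟩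
  rintro ν' ⟨hν', hνx'⟩
  exact measure_ext_of_integral_tail fun x => by rw [← hνx, ← hνx']
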